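/- For a domain $\Omega\subset\mathbb{C}^2$ let $A^2(\Omega)$ be the Bergman space of holomorphic functions on $\Omega$ that are square integrable with respect to Lebesgue measure, let $\mathcal{B}_\Omega: L^2(\Omega)\to A^2(\Omega)$ be the orthogonal projection, and for $u\in L^\infty(\Omega)$ let $T_u:A^2(\Omega)\to A^2(\Omega)$, $T_u f=\mathcal{B}_\Omega(uf)$, be the (bounded) Toeplitz operator with symbol $u$. For an integer $m\ge 6$ let $$X=\Big\{(z_1,z_2)\in\mathbb{C}^2: |z_1|>e,\ |z_2|<\tfrac{1}{|z_1|\log|z_1|}\Big\},\quad Y_m=\Big\{(z_1,z_2)\in\mathbb{C}^2: |z_2|>2,\ \Big||z_1|-\tfrac1{|z_2|}\Big|<\tfrac{1}{|z_2|^m}\Big\},$$ $$Z=\big\{(z_1,z_2)\in\mathbb{C}^2: |z_1|\le e,\ |z_2|\le 2\big\},$$ let $\Omega_m$ be the interior of $X\cup Y_m\cup Z$, and let $\phi(z)=z_1/\overline{z_1}$ (defined for $z_1\neq 0$, hence almost everywhere). Then, for every $m\ge 6$, $\Omega_m$ is a Reinhardt domain (a nonempty connected open set invariant under $(z_1,z_2)\mapsto(\lambda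 z_1,\mu z_2)$ for $|\lambda|=|\mu|=1$), it is unbounded and has finite volume, and the Toeplitz operator $T_\phi$ on $A^2(\Omega_m)$ is nonzero, has infinite rank, and is nilpotent; the smallest $k$ with $T_\phi^k=0$ is $k=\lfloor (m+2)/4\rfloor$. In particular, there are Reinhardt domains in $\mathbb{C}^2$ whose Bergman spaces carry nonzero nilpotent Toeplitz operators of infinite rank. -/

import Mathlib

open MeasureTheory Metric Set Filter Topology
open scoped ENNReal

noncomputable section

namespace Bergman

/-! ### The Bergman space, the Bergman projection and Toeplitz operators -/

/-- The space `L²(Ω)` of an open set `Ω ⊆ ℂ²`, with respect to Lebesgue measure. -/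
abbrev L2 (Ω : TopologicalSpace.Opens (ℂ × ℂ)) : Type :=
  Lp ℂ 2 ((volume : Measure (ℂ × ℂ)).restrict (Ω : Set (ℂ × ℂ)))

/-- The Bergman space `A²(Ω)`: the (classes of) square integrable functions on `Ω` that are
holomorphic on `Ω`. -/
def bergmanSpace (Ω : TopologicalSpace.Opens (ℂ × ℂ)) : Submodule ℂ (L2 Ω) where
  carrier := {f | ∃ g : ℂ × ℂ → ℂ, DifferentiableOn ℂ g (Ω : Set (ℂ × ℂ)) ∧
    f =ᵐ[volume.restrict (Ω : Set (ℂ × ℂ))] g}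
  add_mem' := by
    rintro f₁ f₂ ⟨g₁, hg₁, h₁⟩ ⟨g₂, hg₂, h₂⟩
    exact ⟨g₁ + g₂, hg₁.add hg₂, (Lp.coeFn_add f₁ f₂).trans (h₁.add h₂)⟩
  zero_mem' := ⟨0, differentiableOn_const 0, Lp.coeFn_zero ℂ 2 _⟩
  smul_mem' := by
    rintro c f ⟨g, hg, h⟩
    exact ⟨c • g, hg.const_smul c, (Lp.coeFn_smul c f).trans (h.const_smul c)⟩

/-! The next lemmas show that `A²(Ω)` is complete, which is what makes the orthogonal projection
onto it available. -/

lemma lintegral_polar (F : ℂ → ℝ≥0∞) (hF : Measurable F) : ∫⁻ w, F w =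
    ∫⁻ r in Ioi (0 : ℝ), ∫⁻ θ in Ioo (-Real.pi) Real.pi,
      ENNReal.ofReal r * F (circleMap 0 r θ) := by
  rw [← Complex.lintegral_comp_polarCoord_symm, polarCoord_target, Measure.volume_eq_prod,
    ← Measure.prod_restrict, lintegral_prod]
  · simp [circleMap, Complex.polarCoord_symm_apply, Complex.exp_mul_I]
  · have : Measurable (fun p : ℝ × ℝ => Complex.polarCoord.symm p) := by
      simp only [Complex.polarCoord_symm_apply]; fun_prop
    simp only [smul_eq_mul]
    fun_prop

lemma disc_mean_le (h : ℂ → ℂ) (c : ℂ) (R : ℝ) (hh : DifferentiableOn ℂ h (ball c R)) :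
    volume (ball c R) * ‖h c‖ₑ ≤ ∫⁻ w in ball c R, ‖h w‖ₑ := by
  have key : ∀ F : ℂ → ℝ≥0∞, ∫⁻ w in ball c R, F w =
      ∫⁻ w, (ball (0 : ℂ) R).indicator (fun w => F (c + w)) w := by
    intro F
    rw [← lintegral_indicator measurableSet_ball, ← lintegral_add_left_eq_self _ c]
    congr 1; ext w
    simp [indicator, dist_eq_norm]
  have h1 : volume (ball c R) * ‖h c‖ₑ = ∫⁻ w in ball c R, ‖h c‖ₑ := by simp [mul_comm]
  have hd : DifferentiableOn ℂ (fun w => h (c + w)) (ball 0 R) :=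
    hh.comp (by fun_prop) (fun w hw => by simpa using hw)
  rw [h1, key, key, lintegral_polar _ (measurable_const.indicator measurableSet_ball),
    lintegral_polar]
  · refine setLIntegral_mono' measurableSet_Ioi fun r (hr : 0 < r) => ?_
    rcases le_or_gt R r with hRr | hRr
    · simp [indicator, abs_of_pos hr, not_lt.2 hRr]
    have hmem : ∀ θ, circleMap 0 r θ ∈ ball (0 : ℂ) R := by intro θ; simp [abs_of_pos hr, hRr]
    simp only [indicator_of_mem (hmem _)]
    rw [lintegral_const_mul' _ _ (by simp), lintegral_const_mul' _ _ (by simp)]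
    refine mul_le_mul_right ?_ _
    have hc : DiffContOnCl ℂ (fun w => h (c + w)) (ball 0 |r|) := by
      apply hd.diffContOnCl_ball
      rw [abs_of_pos hr]; exact closedBall_subset_ball hRr
    have hav := DiffContOnCl.circleAverage hc
    have hper : ∫ θ in (0 : ℝ)..2 * Real.pi, h (c + circleMap 0 r θ)
        = ∫ θ in (-Real.pi)..Real.pi, h (c + circleMap 0 r θ) := by
      have := Function.Periodic.intervalIntegral_add_eq (f := fun θ => h (c + circleMap 0 r θ))
        (T := 2 * Real.pi) (fun θ => by simp only [periodic_circleMap 0 r θ]) 0 (-Real.pi)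
      rw [zero_add] at this
      rw [this]; congr 1; ring
    rw [Real.circleAverage_def, hper, intervalIntegral.integral_of_le (by linarith [Real.pi_pos]),
      integral_Ioc_eq_integral_Ioo, add_zero] at hav
    have hpi : (0 : ℝ) < 2 * Real.pi := by positivity
    have hav' : ∫ θ in Ioo (-Real.pi) Real.pi, h (c + circleMap 0 r θ) = (2 * Real.pi) • h c := by
      rw [← hav, smul_smul, mul_inv_cancel₀ hpi.ne', one_smul]
    calc ∫⁻ θ in Ioo (-Real.pi) Real.pi, ‖h c‖ₑ = ‖(2 * Real.pi) • h c‖ₑ := by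
          rw [enorm_smul, Real.enorm_of_nonneg hpi.le]
          simp [mul_comm, ← two_mul]
      _ ≤ _ := by rw [← hav']; exact enorm_integral_le_lintegral_enorm _
  · classical
    have := (hd.continuousOn.enorm).measurable_piecewise (g := 0)
      continuousOn_const measurableSet_ball
    rwa [piecewise_eq_indicator] at this

lemma bidisc_mean_le (h : ℂ × ℂ → ℂ) (z : ℂ × ℂ) (R : ℝ) (hR : 0 < R)
    (hh : DifferentiableOn ℂ h (ball z R)) :
    volume (ball z R) * ‖h z‖ₑ ≤ ∫⁻ w in ball z R, ‖h w‖ₑ := by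
  obtain ⟨a, b⟩ := z
  rw [← ball_prod_same] at hh ⊢
  have hm : AEMeasurable (fun w => ‖h w‖ₑ)
      ((volume.restrict (ball a R)).prod (volume.restrict (ball b R))) := by
    rw [Measure.prod_restrict]
    exact hh.continuousOn.enorm.aemeasurable (measurableSet_ball.prod measurableSet_ball)
  rw [Measure.volume_eq_prod, Measure.prod_prod, ← Measure.prod_restrict, lintegral_prod _ hm]
  calc volume (ball a R) * volume (ball b R) * ‖h (a, b)‖ₑ
      = volume (ball b R) * (volume (ball a R) * ‖h (a, b)‖ₑ) := by ring
    _ ≤ volume (ball b R) * ∫⁻ x in ball a R, ‖h (x, b)‖ₑ := by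
        gcongr
        exact disc_mean_le (fun x => h (x, b)) a R
          (hh.comp (by fun_prop) fun x hx => ⟨hx, mem_ball_self hR⟩)
    _ = ∫⁻ x in ball a R, volume (ball b R) * ‖h (x, b)‖ₑ := by
        rw [lintegral_const_mul' _ _ measure_ball_lt_top.ne]
    _ ≤ _ := by
        refine setLIntegral_mono' measurableSet_ball fun x hx => ?_
        exact disc_mean_le (fun y => h (x, y)) b R
          (hh.comp (by fun_prop) fun y hy => ⟨hx, hy⟩)

/-- Point evaluations on the Bergman space are bounded, locally uniformly. -/
lemma exists_pointwise_bound (R : ℝ) (hR : 0 < R) : ∃ C : ℝ, 0 ≤ C ∧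
    ∀ (Ω : TopologicalSpace.Opens (ℂ × ℂ)) (f : L2 Ω) (h : ℂ × ℂ → ℂ),
      DifferentiableOn ℂ h (Ω : Set (ℂ × ℂ)) →
      f =ᵐ[volume.restrict (Ω : Set (ℂ × ℂ))] h →
      ∀ z, ball z R ⊆ (Ω : Set (ℂ × ℂ)) → ‖h z‖ ≤ C * ‖f‖ := by
  set V : ℝ≥0∞ := volume (ball (0 : ℂ × ℂ) R) with hV
  have hV0 : V ≠ 0 := (measure_ball_pos volume _ hR).ne'
  have hVt : V ≠ ⊤ := measure_ball_lt_top.ne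
  have hCt : V⁻¹ * V ^ (1 / 2 : ℝ) ≠ ⊤ :=
    ENNReal.mul_ne_top (ENNReal.inv_ne_top.2 hV0) (ENNReal.rpow_ne_top_of_nonneg (by norm_num) hVt)
  refine ⟨(V⁻¹ * V ^ (1 / 2 : ℝ)).toReal, ENNReal.toReal_nonneg, ?_⟩
  intro Ω f h hh hf z hz
  have hvz : volume (ball z R) = V := by
    rw [hV, ← Prod.mk.eta (p := z), ← Prod.mk_zero_zero, ← ball_prod_same, ← ball_prod_same,
      Measure.volume_eq_prod, Measure.prod_prod, Measure.prod_prod]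
    simp only [Complex.volume_ball]
  have h1 := bidisc_mean_le h z R hR (hh.mono hz)
  have h2 : ∫⁻ w in ball z R, ‖h w‖ₑ ≤ ‖f‖ₑ * V ^ (1 / 2 : ℝ) := by
    rw [← eLpNorm_one_eq_lintegral_enorm]
    refine (eLpNorm_le_eLpNorm_mul_rpow_measure_univ (q := 2) (by norm_num)
      ((hh.mono hz).continuousOn.aestronglyMeasurable measurableSet_ball)).trans ?_
    rw [Measure.restrict_apply_univ, hvz, Lp.enorm_def, eLpNorm_congr_ae hf]
    rw [show 1 / (1 : ℝ≥0∞).toReal - 1 / (2 : ℝ≥0∞).toReal = 1 / 2 by norm_num]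
    exact mul_le_mul_left (eLpNorm_mono_measure _ (Measure.restrict_mono hz le_rfl)) _
  rw [hvz] at h1
  have h3 : ‖h z‖ₑ ≤ V⁻¹ * V ^ (1 / 2 : ℝ) * ‖f‖ₑ := by
    calc ‖h z‖ₑ = V⁻¹ * (V * ‖h z‖ₑ) := by
          rw [← mul_assoc, ENNReal.inv_mul_cancel hV0 hVt, one_mul]
      _ ≤ V⁻¹ * (‖f‖ₑ * V ^ (1 / 2 : ℝ)) := mul_le_mul_right (h1.trans h2) _
      _ = _ := by ring
  have := ENNReal.toReal_mono (ENNReal.mul_ne_top hCt enorm_ne_top) h3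
  rwa [ENNReal.toReal_mul, toReal_enorm, toReal_enorm] at this

lemma isClosed_bergmanSpace (Ω : TopologicalSpace.Opens (ℂ × ℂ)) :
    IsClosed (bergmanSpace Ω : Set (L2 Ω)) := by
  rw [← isSeqClosed_iff_isClosed]
  intro F f hF hlim
  choose g hg hFg using hF
  have hcauchy := hlim.cauchySeq
  have hbound : ∀ R, 0 < R → ∃ C : ℝ, 0 ≤ C ∧ ∀ n k z, ball z R ⊆ (Ω : Set (ℂ × ℂ)) →
      ‖g n z - g k z‖ ≤ C * ‖F n - F k‖ := by
    intro R hR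
    obtain ⟨C, hC, H⟩ := exists_pointwise_bound R hR
    exact ⟨C, hC, fun n k z hz => H Ω (F n - F k) (g n - g k) ((hg n).sub (hg k))
      ((Lp.coeFn_sub _ _).trans ((hFg n).sub (hFg k))) z hz⟩
  have hC' : ∀ C : ℝ, 0 ≤ C → ∀ ε > 0, ∃ N, ∀ n ≥ N, ∀ k ≥ N, C * ‖F n - F k‖ < ε := by
    intro C hC ε hε
    obtain ⟨N, hN⟩ := Metric.cauchySeq_iff.1 hcauchy (ε / (C + 1)) (by positivity)
    refine ⟨N, fun n hn k hk => ?_⟩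
    have := hN n hn k hk
    rw [dist_eq_norm, lt_div_iff₀ (by positivity)] at this
    nlinarith [norm_nonneg (F n - F k)]
  have hlimpt : ∀ z ∈ (Ω : Set (ℂ × ℂ)), ∃ a, Tendsto (fun n => g n z) atTop (𝓝 a) := by
    intro z hz
    obtain ⟨R, hR, hRz⟩ := Metric.isOpen_iff.1 Ω.isOpen z hz
    obtain ⟨C, hC, H⟩ := hbound R hR
    refine cauchySeq_tendsto_of_complete (Metric.cauchySeq_iff.2 fun ε hε => ?_)
    obtain ⟨N, hN⟩ := hC' C hC ε hε
    exact ⟨N, fun n hn k hk => by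
      rw [dist_eq_norm]; exact (H n k z hRz).trans_lt (hN n hn k hk)⟩
  classical
  choose! G hG using hlimpt
  refine ⟨G, ?_, ?_⟩
  · intro z₀ hz₀
    obtain ⟨R', hR', hRz⟩ := Metric.isOpen_iff.1 Ω.isOpen z₀ hz₀
    obtain ⟨R, hR, rfl⟩ : ∃ R, 0 < R ∧ R' = 3 * R := ⟨R' / 3, by positivity, by ring⟩
    obtain ⟨C, hC, H⟩ := hbound R hR
    have hsub : ∀ z ∈ ball z₀ R, ball z (2 * R) ⊆ (Ω : Set (ℂ × ℂ)) := fun z hz w hw =>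
      hRz (by
        rw [mem_ball] at *
        linarith [dist_triangle w z z₀])
    have hmem : ∀ z ∈ ball z₀ R, z ∈ (Ω : Set (ℂ × ℂ)) := fun z hz =>
      hsub z hz (mem_ball_self (by positivity))
    have hder : ∀ n, ∀ z ∈ ball z₀ R, HasFDerivAt (g n) (fderiv ℂ (g n) z) z := fun n z hz =>
      ((hg n).differentiableAt (Ω.isOpen.mem_nhds (hmem z hz))).hasFDerivAt
    have hfd : ∀ n k, ∀ z ∈ ball z₀ R, ‖fderiv ℂ (g n) z - fderiv ℂ (g k) z‖ ≤
        2 * (C * ‖F n - F k‖) / R := by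
      intro n k z hz
      rw [← ((hder n z hz).sub (hder k z hz)).fderiv]
      have hb : ∀ w ∈ ball z R, ‖(g n - g k) w‖ ≤ C * ‖F n - F k‖ := fun w hw =>
        H n k w fun v hv => hsub z hz (by
          rw [mem_ball] at *
          linarith [dist_triangle v w z])
      refine Complex.norm_fderiv_le_div_of_mapsTo_ball (((hg n).sub (hg k)).mono
        ((ball_subset_ball (by linarith)).trans (hsub z hz))) (fun w hw => ?_) hR
      rw [mem_closedBall, dist_eq_norm]
      have h1 := hb w hw
      have h2 := hb z (mem_ball_self hR)
      linarith [norm_sub_le ((g n - g k) w) ((g n - g k) z)]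
    have hUC : UniformCauchySeqOn (fun n => fderiv ℂ (g n)) atTop (ball z₀ R) := by
      rw [Metric.uniformCauchySeqOn_iff]
      intro ε hε
      obtain ⟨N, hN⟩ := hC' (2 * C / R) (by positivity) ε hε
      refine ⟨N, fun n hn k hk z hz => ?_⟩
      rw [dist_eq_norm]
      refine (hfd n k z hz).trans_lt ?_
      rw [show 2 * (C * ‖F n - F k‖) / R = 2 * C / R * ‖F n - F k‖ by ring]
      exact hN n hn k hk
    have hfl : ∀ z ∈ ball z₀ R, ∃ A, Tendsto (fun n => fderiv ℂ (g n) z) atTop (𝓝 A) :=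
      fun z hz => cauchySeq_tendsto_of_complete (hUC.cauchySeq hz)
    choose! G' hG' using hfl
    exact (hasFDerivAt_of_tendstoUniformlyOn isOpen_ball
      (hUC.tendstoUniformlyOn_of_tendsto hG') hder (fun z hz => hG z (hmem z hz))
      (mem_ball_self hR)).differentiableAt.differentiableWithinAt
  · obtain ⟨ns, hns, hae⟩ := (tendstoInMeasure_of_tendsto_Lp hlim).exists_seq_tendsto_ae
    filter_upwards [hae, ae_all_iff.2 hFg, ae_restrict_mem Ω.isOpen.measurableSet] with z h1 h2 h3
    refine tendsto_nhds_unique h1 ?_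
    simp only [h2]
    exact (hG z h3).comp hns.tendsto_atTop

instance completeSpace_bergmanSpace (Ω : TopologicalSpace.Opens (ℂ × ℂ)) :
    CompleteSpace (bergmanSpace Ω) :=
  (isClosed_bergmanSpace Ω).completeSpace_coe

/-- The Bergman projection: the orthogonal projection of `L²(Ω)` onto `A²(Ω)`. -/
def bergmanProjection (Ω : TopologicalSpace.Opens (ℂ × ℂ)) : L2 Ω →L[ℂ] bergmanSpace Ω :=
  (bergmanSpace Ω).orthogonalProjectionOnto

/-- Multiplication by an essentially bounded measurable function `u`, on `L²(Ω)`. -/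
def mulOperator (Ω : TopologicalSpace.Opens (ℂ × ℂ)) (u : ℂ × ℂ → ℂ)
    (hu : MemLp u ∞ (volume.restrict (Ω : Set (ℂ × ℂ)))) : L2 Ω →L[ℂ] L2 Ω :=
  (ContinuousLinearMap.mul ℂ ℂ).holderL (volume.restrict (Ω : Set (ℂ × ℂ))) ∞ 2 2 (hu.toLp u)

/-- The Toeplitz operator `T_u f = B_Ω (u f)` on `A²(Ω)` with symbol `u`. -/
def toeplitz (Ω : TopologicalSpace.Opens (ℂ × ℂ)) (u : ℂ × ℂ → ℂ)
    (hu : MemLp u ∞ (volume.restrict (Ω : Set (ℂ × ℂ)))) :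
    bergmanSpace Ω →L[ℂ] bergmanSpace Ω :=
  bergmanProjection Ω ∘L mulOperator Ω u hu ∘L (bergmanSpace Ω).subtypeL

/-! ### Reinhardt domains -/

/-- A Reinhardt domain in `ℂ²`: a nonempty connected open set that is invariant under the rotations
`(z₁, z₂) ↦ (λ z₁, μ z₂)` with `|λ| = |μ| = 1`. -/
structure IsReinhardtDomain (Ω : Set (ℂ × ℂ)) : Prop where
  isOpen : IsOpen Ω
  isConnected : IsConnected Ω
  rotation_mem : ∀ a b : ℂ, ‖a‖ = 1 → ‖b‖ = 1 → ∀ z ∈ Ω, (a * z.1, b * z.2) ∈ Ω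

/-! ### The domains `Ω_m` and the symbol -/

def X : Set (ℂ × ℂ) :=
  {z | Real.exp 1 < ‖z.1‖ ∧ ‖z.2‖ < 1 / (‖z.1‖ * Real.log ‖z.1‖)}

def Y (m : ℕ) : Set (ℂ × ℂ) :=
  {z | 2 < ‖z.2‖ ∧ |‖z.1‖ - 1 / ‖z.2‖| < 1 / ‖z.2‖ ^ m}

def Z : Set (ℂ × ℂ) :=
  {z | ‖z.1‖ ≤ Real.exp 1 ∧ ‖z.2‖ ≤ 2}

/-- The open set `Ω_m`. The union `X ∪ Y_m ∪ Z` contains some of its boundary points (a null set,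
coming from the closed bidisc `Z`), so its interior is taken. -/
def Omega (m : ℕ) : TopologicalSpace.Opens (ℂ × ℂ) :=
  ⟨interior (X ∪ Y m ∪ Z), isOpen_interior⟩

/-- The unimodular symbol `φ(z) = z₁ / conj z₁` (with value `0` on the null set `z₁ = 0`). -/
def phi (z : ℂ × ℂ) : ℂ := z.1 / (starRingEnd ℂ) z.1

lemma memLp_phi (Ω : TopologicalSpace.Opens (ℂ × ℂ)) :
    MemLp phi ∞ (volume.restrict (Ω : Set (ℂ × ℂ))) := by
  refine memLp_top_of_bound (C := 1) ?_ (Eventually.of_forall fun z => ?_)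
  · have : Measurable phi :=
      measurable_fst.div (Complex.continuous_conj.measurable.comp measurable_fst)
    exact this.aestronglyMeasurable
  · rw [phi, norm_div, RCLike.norm_conj]
    exact div_self_le_one _

end Bergman

end

noncomputable section

namespace Bergman

/-! `Ω_m` is a bidisc with two cusps attached, and the cusps decide which monomials are square
integrable. On the horizontal cusp the fibre over `|z₁| = x` has height `1 / (x log x)`, so the
squared norm of `z₁ ^ a * z₂ ^ b` behaves like the integral of `x ^ (2a - 2b - 1) / (log x) ^ (2b +
2)`, which is finite exactly when `a ≤ b`; the logarithm rescues the borderline case. On the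
vertical cusp `|z₁|` is comparable to `1 / y` and the fibre has width `2 / y ^ m`, giving the
integral of `y ^ (2b - 2a - m)`, finite exactly when `2b + 2 ≤ 2a + m`. Hence the admissible
exponents form the diagonal band `0 ≤ b - a ≤ (m - 2) / 2` (`sqWeight_lt_top_iff`).

These monomials are total in the Bergman space. Negative Laurent exponents are excluded because
`Ω_m` contains a bidisc around the origin, and square integrability excludes exponents outside the
band. A function orthogonal to the monomials in the band therefore has no Laurent coefficients at
all, and Fourier uniqueness on tori makes it zero (`eq_zero_of_orthogonal`).

The symbol has weight `(2, 0)` under rotations, so `T_φ` sends `z₁ ^ a * z₂ ^ b` to a multiple of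
`z₁ ^ (a + 2) * z₂ ^ b`, with nonzero factor while the target stays in the band
(`exists_T_bergmanMonomial`). Each application lowers `b - a` by 2 and the band has bounded width,
so `T_φ` is nilpotent; counting the steps gives the index. The band is infinite along the diagonal,
so the rank is infinite once a single step fits into it, which is where `6 ≤ m` enters. -/

/-! ### Means over circles and tori -/

/-- Lebesgue measure on one period of the angle variable. -/
def angleMeasure : Measure ℝ := volume.restrict (Ioc 0 (2 * Real.pi))

instance : IsFiniteMeasure angleMeasure := by unfold angleMeasure; infer_instance

lemma integral_angleMeasure (f : ℝ → ℂ) :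
    ∫ s, f s ∂angleMeasure = ∫ s in (0 : ℝ)..2 * Real.pi, f s := by
  rw [intervalIntegral.integral_of_le (by positivity), angleMeasure]

lemma integrable_angleMeasure_prod {F : ℝ × ℝ → ℂ} (hF : Continuous F) :
    Integrable F (angleMeasure.prod angleMeasure) := by
  rw [angleMeasure, Measure.prod_restrict]
  exact (hF.continuousOn.integrableOn_compact (isCompact_Icc.prod isCompact_Icc)).mono_set
    (prod_mono Ioc_subset_Icc_self Ioc_subset_Icc_self)

/-- The unit complex number of angle `s`. -/
def unit (s : ℝ) : ℂ := Complex.exp (s * Complex.I)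

@[simp] lemma norm_unit (s : ℝ) : ‖unit s‖ = 1 := Complex.norm_exp_ofReal_mul_I s

lemma unit_ne_zero (s : ℝ) : unit s ≠ 0 := Complex.exp_ne_zero _

@[fun_prop] lemma continuous_unit : Continuous unit := by unfold unit; fun_prop

lemma unit_periodic : Function.Periodic unit (2 * Real.pi) := by
  intro s
  simp only [unit]
  push_cast
  rw [add_mul, Complex.exp_periodic]

/-- The integral of `f` over the circle through `w` centred at the origin. -/
def circleMean (f : ℂ → ℂ) (w : ℂ) : ℂ := ∫ s, f (unit s * w) ∂angleMeasure

/-- Shifting the angle by `w.arg` costs nothing, by periodicity. -/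
lemma circleMean_eq_circleMap (f : ℂ → ℂ) (w : ℂ) :
    circleMean f w = ∫ s in (0 : ℝ)..2 * Real.pi, f (circleMap 0 ‖w‖ s) := by
  rw [circleMean, integral_angleMeasure]
  have h1 : ∀ s, f (unit s * w) = (fun s => f (circleMap 0 ‖w‖ s)) (s + w.arg) := by
    intro s
    simp only [circleMap, unit, zero_add]
    congr 1
    conv_lhs => rw [← Complex.norm_mul_exp_arg_mul_I w]
    push_cast
    rw [add_mul, Complex.exp_add]
    ring
  simp only [h1]
  rw [intervalIntegral.integral_comp_add_right (fun s => f (circleMap 0 ‖w‖ s))]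
  have := Function.Periodic.intervalIntegral_add_eq (f := fun θ => f (circleMap 0 ‖w‖ θ))
    (T := 2 * Real.pi) (fun θ => by simp only [periodic_circleMap 0 ‖w‖ θ]) w.arg 0
  rw [zero_add] at this ⊢
  rw [← this, add_comm]

lemma I_mul_circleMean {f : ℂ → ℂ} {w : ℂ} (hw : w ≠ 0) :
    Complex.I * circleMean f w = ∮ z in C(0, ‖w‖), (z - 0)⁻¹ • f z := by
  rw [circleMean_eq_circleMap, circleIntegral, ← intervalIntegral.integral_const_mul]
  congr 1
  ext s
  have : circleMap 0 ‖w‖ s ≠ 0 := circleMap_ne_center (norm_ne_zero_iff.2 hw)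
  simp only [deriv_circleMap, smul_eq_mul, sub_zero]
  field_simp

/-- Cauchy's theorem for `f z / z` on the closed annulus between the two circles, whose radii all
lie in the order-connected set `U`. -/
lemma circleMean_eq_of_annulus {U : Set ℝ} (hU : U.OrdConnected) {f : ℂ → ℂ}
    (hf : ∀ z : ℂ, ‖z‖ ∈ U → DifferentiableAt ℂ f z) {w w' : ℂ} (hw : w ≠ 0) (hw' : w' ≠ 0)
    (h : ‖w‖ ∈ U) (h' : ‖w'‖ ∈ U) : circleMean f w = circleMean f w' := by
  wlog hle : ‖w‖ ≤ ‖w'‖ generalizing w w'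
  · exact (this hw' hw h' h (le_of_not_ge hle)).symm
  apply mul_left_cancel₀ Complex.I_ne_zero
  rw [I_mul_circleMean hw, I_mul_circleMean hw']
  symm
  have hmem : ∀ z ∈ closedBall (0 : ℂ) ‖w'‖ \ ball 0 ‖w‖, ‖z‖ ∈ U := by
    intro z hz
    simp only [Set.mem_sdiff, mem_closedBall, mem_ball, dist_zero_right, not_lt] at hz
    exact hU.out h h' ⟨hz.2, hz.1⟩
  refine Complex.circleIntegral_sub_center_inv_smul_eq_of_differentiable_on_annulus_off_countable
    (norm_pos_iff.2 hw) hle countable_empty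
    (fun z hz => (hf z (hmem z hz)).continuousAt.continuousWithinAt) (fun z hz => hf z (hmem z ?_))
  exact ⟨ball_subset_closedBall hz.1.1, fun h => hz.1.2 (ball_subset_closedBall h)⟩

/-- The mean value property; the factor `2π` appears because `circleMean` is not normalised. -/
lemma circleMean_eq_center {f : ℂ → ℂ} {w : ℂ} {R : ℝ} (hR : ‖w‖ < R)
    (hf : DifferentiableOn ℂ f (ball 0 R)) : circleMean f w = 2 * Real.pi * f 0 := by
  have hc : DiffContOnCl ℂ f (ball 0 |‖w‖|) := by
    apply hf.diffContOnCl_ball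
    rw [abs_norm]; exact closedBall_subset_ball hR
  have hav := DiffContOnCl.circleAverage hc
  rw [Real.circleAverage_def, ← circleMean_eq_circleMap] at hav
  rw [← hav, Complex.real_smul]
  push_cast
  have : (Real.pi : ℂ) ≠ 0 := by exact_mod_cast Real.pi_ne_zero
  field_simp

/-- The rotation of `ℂ²` by a pair of angles. -/
def rot (τ : ℝ × ℝ) (z : ℂ × ℂ) : ℂ × ℂ := (unit τ.1 * z.1, unit τ.2 * z.2)

/-- The integral of `h` over the torus through `z`. -/
def torusMean (h : ℂ × ℂ → ℂ) (z : ℂ × ℂ) : ℂ :=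
  ∫ τ, h (rot τ z) ∂(angleMeasure.prod angleMeasure)

/-- The Reinhardt set of the points whose moduli lie in `S`. -/
def reinhardt (S : Set (ℝ × ℝ)) : Set (ℂ × ℂ) := {z | (‖z.1‖, ‖z.2‖) ∈ S}

lemma rot_mem_reinhardt {S : Set (ℝ × ℝ)} (τ : ℝ × ℝ) {z : ℂ × ℂ} :
    rot τ z ∈ reinhardt S ↔ z ∈ reinhardt S := by
  simp [reinhardt, rot]

lemma continuous_rot : Continuous (fun p : (ℝ × ℝ) × (ℂ × ℂ) => rot p.1 p.2) := by
  unfold rot; fun_prop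

lemma isOpen_reinhardt {S : Set (ℝ × ℝ)} (hS : IsOpen S) : IsOpen (reinhardt S) :=
  hS.preimage (f := fun z : ℂ × ℂ => (‖z.1‖, ‖z.2‖)) (by fun_prop)

lemma continuous_comp_rot {S : Set (ℝ × ℝ)} {h : ℂ × ℂ → ℂ}
    (hh : ContinuousOn h (reinhardt S)) {z : ℂ × ℂ} (hz : z ∈ reinhardt S) :
    Continuous (fun τ => h (rot τ z)) :=
  hh.comp_continuous (continuous_rot.comp (by fun_prop : Continuous fun τ : ℝ × ℝ => (τ, z)))
    fun τ => (rot_mem_reinhardt τ).2 hz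

lemma torusMean_eq_snd_fst {S : Set (ℝ × ℝ)} {h : ℂ × ℂ → ℂ}
    (hh : ContinuousOn h (reinhardt S)) {z : ℂ × ℂ} (hz : z ∈ reinhardt S) :
    torusMean h z = ∫ t, circleMean (fun x => h (x, unit t * z.2)) z.1 ∂angleMeasure :=
  integral_prod_symm _ (integrable_angleMeasure_prod (continuous_comp_rot hh hz))

lemma torusMean_eq_fst_snd {S : Set (ℝ × ℝ)} {h : ℂ × ℂ → ℂ}
    (hh : ContinuousOn h (reinhardt S)) {z : ℂ × ℂ} (hz : z ∈ reinhardt S) :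
    torusMean h z = ∫ s, circleMean (fun y => h (unit s * z.1, y)) z.2 ∂angleMeasure :=
  integral_prod _ (integrable_angleMeasure_prod (continuous_comp_rot hh hz))

lemma torusMean_eq_of_product {U₁ U₂ : Set ℝ} (hU₁ : U₁.OrdConnected) (hU₂ : U₂.OrdConnected)
    {h : ℂ × ℂ → ℂ} (hh : ∀ z ∈ reinhardt (U₁ ×ˢ U₂), DifferentiableAt ℂ h z)
    {z z' : ℂ × ℂ} (h₁ : z.1 ≠ 0) (h₂ : z.2 ≠ 0) (h₁' : z'.1 ≠ 0) (h₂' : z'.2 ≠ 0)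
    (hz : z ∈ reinhardt (U₁ ×ˢ U₂)) (hz' : z' ∈ reinhardt (U₁ ×ˢ U₂)) :
    torusMean h z = torusMean h z' := by
  have hc : ContinuousOn h (reinhardt (U₁ ×ˢ U₂)) := fun z hz =>
    (hh z hz).continuousAt.continuousWithinAt
  have hm : (z'.1, z.2) ∈ reinhardt (U₁ ×ˢ U₂) := ⟨hz'.1, hz.2⟩
  -- One radius is changed at a time, through the corner of the rectangle of moduli.
  trans torusMean h (z'.1, z.2)
  · rw [torusMean_eq_snd_fst hc hz, torusMean_eq_snd_fst hc hm]
    congr 1; ext t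
    refine circleMean_eq_of_annulus hU₁ (fun x hx => ?_) h₁ h₁' hz.1 hz'.1
    have := hh (x, unit t * z.2) ⟨hx, by simpa using hz.2⟩
    exact this.comp x (by fun_prop : DifferentiableAt ℂ (fun x => (x, unit t * z.2)) x)
  · rw [torusMean_eq_fst_snd hc hm, torusMean_eq_fst_snd hc hz']
    congr 1; ext s
    refine circleMean_eq_of_annulus hU₂ (fun y hy => ?_) h₂ h₂' hz.2 hz'.2
    have := hh (unit s * z'.1, y) ⟨by simpa using hz'.1, hy⟩
    exact this.comp y (by fun_prop : DifferentiableAt ℂ (fun y => (unit s * z'.1, y)) y)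

/-- Torus integrals of a holomorphic function on a connected Reinhardt domain that misses the
coordinate axes do not depend on the torus. -/
lemma torusMean_eq {S : Set (ℝ × ℝ)} (hS : IsOpen S) (hpos : ∀ r ∈ S, 0 < r.1 ∧ 0 < r.2)
    (hconn : IsPreconnected S) {h : ℂ × ℂ → ℂ} (hh : DifferentiableOn ℂ h (reinhardt S))
    {z z' : ℂ × ℂ} (hz : z ∈ reinhardt S) (hz' : z' ∈ reinhardt S) :
    torusMean h z = torusMean h z' := by
  let c : ℝ × ℝ → ℂ × ℂ := fun r => (r.1, r.2)
  have hc : ∀ r ∈ S, c r ∈ reinhardt S := by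
    intro r hr
    simp only [reinhardt, mem_ofPred_eq, c, Complex.norm_real, Real.norm_eq_abs,
      abs_of_pos (hpos r hr).1, abs_of_pos (hpos r hr).2]
    exact hr
  -- A small rectangle of moduli around any point lies in `S`, so the product case makes the torus
  -- integral locally constant; connectedness then makes it constant.
  have hloc : ∀ z ∈ reinhardt S, ∀ᶠ r in 𝓝 (‖z.1‖, ‖z.2‖), torusMean h (c r) = torusMean h z := by
    intro z hz
    obtain ⟨ε, hε, hb⟩ := Metric.isOpen_iff.1 hS _ hz
    rw [← ball_prod_same] at hb
    have hdiff : ∀ w ∈ reinhardt (ball ‖z.1‖ ε ×ˢ ball ‖z.2‖ ε), DifferentiableAt ℂ h w :=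
      fun w hw => hh.differentiableAt ((isOpen_reinhardt hS).mem_nhds (hb hw))
    have hnz : ∀ w ∈ reinhardt (ball ‖z.1‖ ε ×ˢ ball ‖z.2‖ ε), w.1 ≠ 0 ∧ w.2 ≠ 0 := fun w hw =>
      ⟨norm_pos_iff.1 (hpos _ (hb hw)).1, norm_pos_iff.1 (hpos _ (hb hw)).2⟩
    have hz0 : z ∈ reinhardt (ball ‖z.1‖ ε ×ˢ ball ‖z.2‖ ε) :=
      ⟨mem_ball_self hε, mem_ball_self hε⟩
    have ho : ball ‖z.1‖ ε ×ˢ ball ‖z.2‖ ε ∈ 𝓝 (‖z.1‖, ‖z.2‖) :=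
      (isOpen_ball.prod isOpen_ball).mem_nhds hz0
    filter_upwards [ho] with r hr
    have hr' : c r ∈ reinhardt (ball ‖z.1‖ ε ×ˢ ball ‖z.2‖ ε) := by
      simp only [reinhardt, mem_ofPred_eq, c, Complex.norm_real, Real.norm_eq_abs,
        abs_of_pos (hpos r (hb hr)).1, abs_of_pos (hpos r (hb hr)).2]
      exact hr
    have oc : ∀ x : ℝ, (ball x ε).OrdConnected := fun x => by
      rw [Real.ball_eq_Ioo]; exact ordConnected_Ioo
    exact torusMean_eq_of_product (oc _) (oc _) hdiff (hnz _ hr').1 (hnz _ hr').2 (hnz _ hz0).1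
      (hnz _ hz0).2 hr' hz0
  have key : ∀ r ∈ S, ∀ r' ∈ S, torusMean h (c r) = torusMean h (c r') := by
    intro r hr r' hr'
    refine hconn.induction₂ (fun r r' => torusMean h (c r) = torusMean h (c r')) (fun r hr => ?_)
      (fun _ _ _ _ _ _ h₁ h₂ => h₁.trans h₂) (fun _ _ _ _ h₁ => h₁.symm) hr hr'
    have := hloc (c r) (hc r hr)
    simp only [c, Complex.norm_real, Real.norm_eq_abs, abs_of_pos (hpos r hr).1,
      abs_of_pos (hpos r hr).2] at this
    exact (this.filter_mono nhdsWithin_le_nhds).mono fun _ h => h.symm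
  rw [← (hloc z hz).self_of_nhds, ← (hloc z' hz').self_of_nhds]
  exact key _ hz _ hz'

/-! ### Uniqueness of Fourier coefficients -/

lemma fourier_uniqueness {F : ℝ → ℂ} (hF : Continuous F) (hper : Function.Periodic F (2 * Real.pi))
    (h0 : ∀ n : ℤ, ∫ s, unit s ^ n * F s ∂angleMeasure = 0) (x : ℝ) : F x = 0 := by
  have hT : Fact (0 < 2 * Real.pi) := ⟨by positivity⟩
  let f : C(AddCircle (2 * Real.pi), ℂ) := ⟨hper.lift, continuous_coinduced_dom.2 hF⟩
  have hcoef : ∀ n, fourierCoeff f n = 0 := by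
    intro n
    rw [fourierCoeff_eq_intervalIntegral _ _ 0, zero_add, ← integral_angleMeasure]
    have : ∀ s : ℝ, fourier (-n) (s : AddCircle (2 * Real.pi)) • f s = unit s ^ (-n) * F s := by
      intro s
      rw [fourier_coe_apply, smul_eq_mul, unit, ← Complex.exp_int_mul]
      congr 2
      have : (Real.pi : ℂ) ≠ 0 := by exact_mod_cast Real.pi_ne_zero
      push_cast
      field_simp
    simp only [this, h0, smul_zero]
  have hs : fourierCoeff f = 0 := funext hcoef
  -- The zero coefficients are summable, so the Fourier series converges pointwise to `F`, and its
  -- sum is zero.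
  have := has_pointwise_sum_fourier_series_of_summable (f := f) (by rw [hs]; exact summable_zero) x
  simp only [hs, Pi.zero_apply, zero_smul] at this
  exact this.unique hasSum_zero

/-! ### The geometry of `Ω_m` -/

/-- The moduli of the points of the open bidisc. -/
def shadowCore : Set (ℝ × ℝ) := Ioo 0 (Real.exp 1) ×ˢ Ioo 0 2

/-- The moduli of the points of the horizontal cusp. -/
def shadowHorizontal : Set (ℝ × ℝ) := {r | 2 < r.1 ∧ 0 < r.2 ∧ r.2 * (r.1 * Real.log r.1) < 1}

/-- The moduli of the points of the vertical cusp. -/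
def shadowVertical (m : ℕ) : Set (ℝ × ℝ) := {r | 1 < r.2 ∧ |r.1 - 1 / r.2| < 1 / r.2 ^ m}

/-- The moduli of the points of `Ω_m`, up to a null set. -/
def shadow (m : ℕ) : Set (ℝ × ℝ) := shadowCore ∪ shadowHorizontal ∪ shadowVertical m

/-- `shadowHorizontal` starts at 2 instead of `e`, so as to overlap the open core. This bound keeps
the added piece below height 1, hence inside `Z`. -/
lemma one_lt_mul_log {x : ℝ} (hx : 2 < x) : 1 < x * Real.log x := by
  have h := Real.log_two_gt_d9
  have := Real.log_lt_log two_pos hx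
  nlinarith

lemma two_lt_exp_one : (2 : ℝ) < Real.exp 1 := by linarith [Real.exp_one_gt_d9]

/-- The half-width `1 / y ^ m` is at most `1 / y`, so the cusp stays off the axis `z₁ = 0`. -/
lemma shadowVertical_bounds {m : ℕ} (hm : 1 ≤ m) {r : ℝ × ℝ} (hr : r ∈ shadowVertical m) :
    0 < r.1 ∧ r.1 < 2 / r.2 := by
  obtain ⟨h1, h2⟩ := hr
  have hy : 0 < r.2 := by linarith
  have h3 : 1 / r.2 ^ m ≤ 1 / r.2 :=
    one_div_le_one_div_of_le hy (le_self_pow₀ h1.le (by omega))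
  rw [abs_lt] at h2
  rw [show 2 / r.2 = 1 / r.2 + 1 / r.2 by ring]
  constructor <;> linarith

lemma shadow_pos {m : ℕ} (hm : 1 ≤ m) (r : ℝ × ℝ) (hr : r ∈ shadow m) : 0 < r.1 ∧ 0 < r.2 := by
  rcases hr with (hr | hr) | hr
  · exact ⟨hr.1.1, hr.2.1⟩
  · exact ⟨by linarith [hr.1], hr.2.1⟩
  · exact ⟨(shadowVertical_bounds hm hr).1, by linarith [hr.1]⟩

lemma isOpen_shadowHorizontal : IsOpen shadowHorizontal := by
  have h1 : ContinuousOn (fun r : ℝ × ℝ => r.2 * (r.1 * Real.log r.1)) {r | 2 < r.1} := by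
    refine continuousOn_snd.mul (continuousOn_fst.mul (continuousOn_fst.log fun r hr => ?_))
    have : (2 : ℝ) < r.1 := hr
    linarith
  have ho : IsOpen {r : ℝ × ℝ | 2 < r.1} := isOpen_lt continuous_const continuous_fst
  have h2 := h1.isOpen_inter_preimage ho (isOpen_Iio (a := (1 : ℝ)))
  have h3 : IsOpen {r : ℝ × ℝ | 0 < r.2} := isOpen_lt continuous_const continuous_snd
  convert h2.inter h3 using 1
  ext r
  simp only [shadowHorizontal, mem_ofPred_eq, mem_inter_iff, mem_preimage, mem_Iio]
  tauto

lemma isOpen_shadowVertical (m : ℕ) : IsOpen (shadowVertical m) := by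
  have ho : IsOpen {r : ℝ × ℝ | 1 < r.2} := isOpen_lt continuous_const continuous_snd
  have h1 : ContinuousOn (fun r : ℝ × ℝ => |r.1 - 1 / r.2| - 1 / r.2 ^ m) {r | 1 < r.2} := by
    have h0 : ∀ r ∈ {r : ℝ × ℝ | 1 < r.2}, r.2 ≠ 0 := fun r hr => by
      have : (1 : ℝ) < r.2 := hr
      linarith
    exact ((continuousOn_fst.sub (continuousOn_const.div continuousOn_snd h0)).abs).sub
      (continuousOn_const.div (continuousOn_snd.pow m) fun r hr => pow_ne_zero m (h0 r hr))
  convert h1.isOpen_inter_preimage ho (isOpen_Iio (a := (0 : ℝ))) using 1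
  ext r
  simp [shadowVertical]

lemma isOpen_shadow (m : ℕ) : IsOpen (shadow m) :=
  ((isOpen_Ioo.prod isOpen_Ioo).union isOpen_shadowHorizontal).union (isOpen_shadowVertical m)

lemma isPreconnected_shadowHorizontal : IsPreconnected shadowHorizontal := by
  have hpos : ∀ x : ℝ, 2 < x → 0 < x * Real.log x := fun x hx => by linarith [one_lt_mul_log hx]
  -- Rescaling each fibre to unit height straightens the cusp into a product of intervals.
  have : shadowHorizontal =
      (fun p : ℝ × ℝ => (p.1, p.2 / (p.1 * Real.log p.1))) '' (Ioi 2 ×ˢ Ioo 0 1) := by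
    ext ⟨x, y⟩
    constructor
    · rintro ⟨h1, h2, h3⟩
      have := hpos x h1
      exact ⟨(x, y * (x * Real.log x)), ⟨h1, by dsimp only at *; positivity, h3⟩,
        by simp only [mul_div_cancel_right₀ _ this.ne']⟩
    · rintro ⟨⟨x', t⟩, ⟨h1, h2, h3⟩, h4⟩
      simp only [Prod.mk.injEq] at h4
      obtain ⟨rfl, rfl⟩ := h4
      have := hpos _ h1
      refine ⟨h1, div_pos h2 this, ?_⟩
      dsimp only at *
      rwa [div_mul_cancel₀ _ this.ne']
  rw [this]
  refine (isPreconnected_Ioi.prod isPreconnected_Ioo).image _ ?_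
  refine continuousOn_fst.prodMk (continuousOn_snd.div (continuousOn_fst.mul
    (continuousOn_fst.log fun p hp => ?_)) fun p hp => (hpos _ hp.1).ne')
  have : (2 : ℝ) < p.1 := hp.1
  linarith

lemma isPreconnected_shadowVertical (m : ℕ) : IsPreconnected (shadowVertical m) := by
  have : shadowVertical m =
      (fun p : ℝ × ℝ => (1 / p.1 + p.2 / p.1 ^ m, p.1)) '' (Ioi 1 ×ˢ Ioo (-1) 1) := by
    ext ⟨x, y⟩
    constructor
    · rintro ⟨h1, h2⟩
      have hy : 0 < y := by linarith [h1]
      dsimp only at h2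
      rw [lt_div_iff₀ (by positivity), ← abs_of_pos (pow_pos hy m), ← abs_mul, abs_lt] at h2
      refine ⟨(y, (x - 1 / y) * y ^ m), ⟨h1, h2⟩, ?_⟩
      simp only [Prod.mk.injEq, and_true]
      field_simp
      ring
    · rintro ⟨⟨y', t⟩, ⟨h1, h2⟩, h4⟩
      simp only [Prod.mk.injEq] at h4
      obtain ⟨rfl, rfl⟩ := h4
      have hy : 0 < y' := by linarith [mem_Ioi.1 h1]
      refine ⟨h1, ?_⟩
      dsimp only
      rw [add_sub_cancel_left, abs_div, abs_of_pos (pow_pos hy m)]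
      exact div_lt_div_of_pos_right (abs_lt.2 h2) (by positivity)
  rw [this]
  refine (isPreconnected_Ioi.prod isPreconnected_Ioo).image _ ?_
  have h0 : ∀ p ∈ Ioi (1 : ℝ) ×ˢ Ioo (-1 : ℝ) 1, p.1 ≠ 0 := fun p hp => by
    have : (1 : ℝ) < p.1 := hp.1
    linarith
  exact ((continuousOn_const.div continuousOn_fst h0).add (continuousOn_snd.div
    (continuousOn_fst.pow m) fun p hp => pow_ne_zero m (h0 p hp))).prodMk continuousOn_fst

lemma isPreconnected_shadow (m : ℕ) : IsPreconnected (shadow m) := by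
  have he := Real.exp_one_gt_d9
  have hA : IsPreconnected shadowCore := isPreconnected_Ioo.prod isPreconnected_Ioo
  -- The two points are common to the core and a cusp: `(2/3, 3/2)` lies on the spine `r.1 = 1 /
  -- r.2` of the vertical cusp, and `(5/2, 1/10)` lies in the horizontal cusp with `2 < 5/2 < e`.
  refine IsPreconnected.union (2 / 3, 3 / 2) (Or.inl ?_) ?_
    (IsPreconnected.union (5 / 2, 1 / 10) ?_ ?_ hA isPreconnected_shadowHorizontal)
    (isPreconnected_shadowVertical m)
  · refine ⟨⟨?_, ?_⟩, ?_, ?_⟩ <;> norm_num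
    linarith
  · refine ⟨by norm_num, ?_⟩
    norm_num
  · refine ⟨⟨?_, ?_⟩, ?_, ?_⟩ <;> norm_num
    linarith
  · refine ⟨by norm_num, by norm_num, ?_⟩
    have := Real.log_le_sub_one_of_pos (x := 5 / 2) (by norm_num)
    norm_num at this ⊢
    linarith

lemma reinhardt_shadow_subset (m : ℕ) :
    reinhardt (shadow m) ⊆ (Omega m : Set (ℂ × ℂ)) := by
  refine interior_maximal ?_ (isOpen_reinhardt (isOpen_shadow m))
  have he := two_lt_exp_one
  rintro z ((hz | ⟨h1, h2, h3⟩) | ⟨h1, h2⟩)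
  · exact Or.inr ⟨hz.1.2.le, hz.2.2.le⟩
  · have hl := one_lt_mul_log h1
    dsimp only at *
    rcases le_or_gt ‖z.1‖ (Real.exp 1) with h | h
    · refine Or.inr ⟨h, ?_⟩
      nlinarith
    · exact Or.inl (Or.inl ⟨h, by rwa [lt_div_iff₀ (by linarith)]⟩)
  · dsimp only at *
    rcases le_or_gt ‖z.2‖ 2 with h | h
    · refine Or.inr ⟨?_, h⟩
      have h3 : 1 / ‖z.2‖ ^ m ≤ 1 := by
        rw [div_le_one (by positivity)]; exact one_le_pow₀ h1.le
      have h4 : 1 / ‖z.2‖ ≤ 1 := by rw [div_le_one (by linarith)]; exact h1.le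
      linarith [(abs_lt.1 h2).2]
    · exact Or.inl (Or.inr ⟨h, h2⟩)

/-! ### Null sets, connectedness and unboundedness -/

lemma volume_fst_norm_eq (ρ : ℝ) : volume {z : ℂ × ℂ | ‖z.1‖ = ρ} = 0 := by
  have h : volume {w : ℂ | ‖w‖ = ρ} = 0 := by
    convert Measure.addHaar_sphere (volume : Measure ℂ) 0 ρ using 2
    ext; simp
  exact Measure.quasiMeasurePreserving_fst.preimage_null h

lemma volume_snd_norm_eq (ρ : ℝ) : volume {z : ℂ × ℂ | ‖z.2‖ = ρ} = 0 := by
  have h : volume {w : ℂ | ‖w‖ = ρ} = 0 := by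
    convert Measure.addHaar_sphere (volume : Measure ℂ) 0 ρ using 2
    ext; simp
  exact Measure.quasiMeasurePreserving_snd.preimage_null h

/-- Only points on the axes or on the faces `|z₁| = e`, `|z₂| = 2` can be lost. Integrals over `Ω_m`
may therefore be taken over `reinhardt (shadow m)`, where both coordinates are nonzero. -/
lemma volume_Omega_sdiff (m : ℕ) :
    volume ((Omega m : Set (ℂ × ℂ)) \ reinhardt (shadow m)) = 0 := by
  refine measure_mono_null (t := ({z | ‖z.1‖ = 0} ∪ {z | ‖z.1‖ = Real.exp 1}) ∪
    ({z | ‖z.2‖ = 0} ∪ {z | ‖z.2‖ = 2})) ?_ ?_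
  · rintro z ⟨hz, hn⟩
    by_contra hb
    apply hn
    simp only [mem_union, mem_ofPred_eq, not_or] at hb
    obtain ⟨⟨h1, h2⟩, h3, h4⟩ := hb
    have h1 : 0 < ‖z.1‖ := lt_of_le_of_ne (norm_nonneg _) (Ne.symm h1)
    have h3 : 0 < ‖z.2‖ := lt_of_le_of_ne (norm_nonneg _) (Ne.symm h3)
    rcases interior_subset hz with (⟨h5, h6⟩ | ⟨h5, h6⟩) | ⟨h5, h6⟩
    · have h7 : 2 < ‖z.1‖ := two_lt_exp_one.trans h5
      rw [lt_div_iff₀ (by linarith [one_lt_mul_log h7])] at h6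
      exact Or.inl (Or.inr ⟨h7, h3, h6⟩)
    · exact Or.inr ⟨by linarith, h6⟩
    · exact Or.inl (Or.inl ⟨⟨h1, lt_of_le_of_ne h5 h2⟩, h3, lt_of_le_of_ne h6 h4⟩)
  · simp only [measure_union_null_iff, volume_fst_norm_eq, volume_snd_norm_eq, and_self]

lemma restrict_Omega (m : ℕ) : (volume : Measure (ℂ × ℂ)).restrict (Omega m : Set (ℂ × ℂ)) =
    volume.restrict (reinhardt (shadow m)) := by
  refine Measure.restrict_congr_set ?_
  rw [ae_eq_set]
  exact ⟨volume_Omega_sdiff m, by simp [sdiff_eq_empty.2 (reinhardt_shadow_subset m)]⟩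

/-- The part of `Ω_m` outside the closure is open and null, hence empty. Connectedness thus passes
from the smaller set to `Ω_m`. -/
lemma Omega_subset_closure (m : ℕ) :
    (Omega m : Set (ℂ × ℂ)) ⊆ closure (reinhardt (shadow m)) := by
  have ho : IsOpen ((Omega m : Set (ℂ × ℂ)) \ closure (reinhardt (shadow m))) :=
    (Omega m).isOpen.sdiff isClosed_closure
  have h0 : volume ((Omega m : Set (ℂ × ℂ)) \ closure (reinhardt (shadow m))) = 0 :=
    measure_mono_null (sdiff_subset_sdiff_right subset_closure) (volume_Omega_sdiff m)
  rw [ho.measure_eq_zero_iff (volume : Measure (ℂ × ℂ))] at h0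
  exact sdiff_eq_empty.1 h0

lemma isPreconnected_reinhardt {S : Set (ℝ × ℝ)} (hS : IsPreconnected S)
    (hpos : ∀ r ∈ S, 0 < r.1 ∧ 0 < r.2) : IsPreconnected (reinhardt S) := by
  have : reinhardt S = (fun p : (ℝ × ℝ) × (ℝ × ℝ) => rot p.2 ((p.1.1 : ℂ), (p.1.2 : ℂ))) ''
      (S ×ˢ univ) := by
    ext z
    constructor
    · intro hz
      refine ⟨((‖z.1‖, ‖z.2‖), (z.1.arg, z.2.arg)), ⟨hz, mem_univ _⟩, ?_⟩
      ext
      · exact (mul_comm _ _).trans (Complex.norm_mul_exp_arg_mul_I z.1)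
      · exact (mul_comm _ _).trans (Complex.norm_mul_exp_arg_mul_I z.2)
    · rintro ⟨⟨r, τ⟩, ⟨hr, -⟩, rfl⟩
      rw [rot_mem_reinhardt]
      simp only [reinhardt, mem_ofPred_eq, Complex.norm_real, Real.norm_eq_abs,
        abs_of_pos (hpos r hr).1, abs_of_pos (hpos r hr).2]
      exact hr
  rw [this]
  refine (hS.prod isPreconnected_univ).image _ (Continuous.continuousOn ?_)
  unfold rot
  fun_prop

lemma isReinhardtDomain_Omega {m : ℕ} (hm : 1 ≤ m) :
    IsReinhardtDomain (Omega m : Set (ℂ × ℂ)) where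
  isOpen := (Omega m).isOpen
  isConnected := by
    refine ⟨⟨(1, 1), reinhardt_shadow_subset m (Or.inl (Or.inl ?_))⟩, ?_⟩
    · refine ⟨⟨?_, ?_⟩, ?_, ?_⟩ <;> norm_num
    · exact (isPreconnected_reinhardt (isPreconnected_shadow m) (shadow_pos hm)).subset_closure
        (reinhardt_shadow_subset m) (Omega_subset_closure m)
  rotation_mem := by
    intro a b ha hb z hz
    have ha0 : a ≠ 0 := norm_ne_zero_iff.1 (by rw [ha]; exact one_ne_zero)
    have hb0 : b ≠ 0 := norm_ne_zero_iff.1 (by rw [hb]; exact one_ne_zero)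
    have hc : Continuous (fun w : ℂ × ℂ => (a⁻¹ * w.1, b⁻¹ * w.2)) := by fun_prop
    -- The rotated copy of `Ω_m`, written as a preimage under the inverse rotation, is an open
    -- subset of `X ∪ Y m ∪ Z`, hence lies in its interior.
    refine interior_maximal (fun w hw => ?_) ((Omega m).isOpen.preimage hc)
      (show (a * z.1, b * z.2) ∈ _ from ?_)
    · have := interior_subset hw
      simpa [X, Y, Z, ha, hb] using this
    · simpa [mem_preimage, ha0, hb0] using hz

lemma not_isBounded_Omega (m : ℕ) : ¬ Bornology.IsBounded (Omega m : Set (ℂ × ℂ)) := by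
  intro hb
  obtain ⟨R, hR⟩ := hb.exists_norm_le
  set x : ℝ := max R 2 + 1 with hx
  have h2 : 2 < x := by linarith [le_max_right R 2]
  have hl := one_lt_mul_log h2
  have hmem : ((x : ℂ), ((1 / 2 / (x * Real.log x) : ℝ) : ℂ)) ∈ reinhardt (shadow m) := by
    refine Or.inl (Or.inr ?_)
    have h3 : 0 < 1 / 2 / (x * Real.log x) := by positivity
    simp only [Complex.norm_real, Real.norm_eq_abs, abs_of_pos h3, abs_of_pos (by linarith : 0 < x)]
    refine ⟨h2, h3, ?_⟩
    dsimp only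
    rw [div_mul_cancel₀ _ (by linarith)]
    norm_num
  have := (norm_fst_le _).trans (hR _ (reinhardt_shadow_subset m hmem))
  simp only [Complex.norm_real, Real.norm_eq_abs, abs_of_pos (by linarith : 0 < x)] at this
  linarith [le_max_left R 2]

/-! ### Square integrable monomials -/

lemma lintegral_comp_norm {G : ℝ → ℝ≥0∞} (hG : Measurable G) :
    ∫⁻ w : ℂ, G ‖w‖ = ENNReal.ofReal (2 * Real.pi) *
      ∫⁻ r in Ioi (0 : ℝ), ENNReal.ofReal r * G r := by
  rw [lintegral_polar (fun w => G ‖w‖) (hG.comp measurable_norm),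
    ← lintegral_const_mul' _ _ (by finiteness)]
  refine setLIntegral_congr_fun measurableSet_Ioi fun r hr => ?_
  simp only [norm_circleMap_zero, abs_of_pos (mem_Ioi.1 hr), lintegral_const,
    Measure.restrict_apply MeasurableSet.univ, univ_inter, Real.volume_Ioo]
  rw [mul_comm]
  congr 2
  ring

lemma lintegral_comp_norms {G : ℝ × ℝ → ℝ≥0∞} (hG : Measurable G) :
    ∫⁻ z : ℂ × ℂ, G (‖z.1‖, ‖z.2‖) = ENNReal.ofReal (2 * Real.pi) ^ 2 *
      ∫⁻ x in Ioi (0 : ℝ), ∫⁻ y in Ioi (0 : ℝ), ENNReal.ofReal (x * y) * G (x, y) := by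
  have hm : Measurable fun x : ℝ => ∫⁻ y in Ioi (0 : ℝ), ENNReal.ofReal y * G (x, y) :=
    Measurable.lintegral_prod_right' (f := fun p : ℝ × ℝ => ENNReal.ofReal p.2 * G (p.1, p.2))
      (by fun_prop)
  rw [Measure.volume_eq_prod, lintegral_prod _ (by fun_prop)]
  have h1 : ∀ z₁ : ℂ, ∫⁻ z₂ : ℂ, G (‖z₁‖, ‖z₂‖) = ENNReal.ofReal (2 * Real.pi) *
      ∫⁻ y in Ioi (0 : ℝ), ENNReal.ofReal y * G (‖z₁‖, y) := fun z₁ =>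
    lintegral_comp_norm (G := fun y => G (‖z₁‖, y)) (by fun_prop)
  simp only [h1]
  rw [lintegral_const_mul' _ _ (by finiteness), lintegral_comp_norm hm, ← mul_assoc, ← sq]
  congr 1
  refine setLIntegral_congr_fun measurableSet_Ioi fun x hx => ?_
  rw [← lintegral_const_mul' _ _ (by finiteness)]
  congr 1; ext y
  rw [ENNReal.ofReal_mul (le_of_lt hx), mul_assoc]

lemma lintegral_comp_norms_symm {G : ℝ × ℝ → ℝ≥0∞} (hG : Measurable G) :
    ∫⁻ z : ℂ × ℂ, G (‖z.1‖, ‖z.2‖) = ENNReal.ofReal (2 * Real.pi) ^ 2 *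
      ∫⁻ y in Ioi (0 : ℝ), ∫⁻ x in Ioi (0 : ℝ), ENNReal.ofReal (x * y) * G (x, y) := by
  rw [lintegral_comp_norms hG, lintegral_lintegral_swap]
  exact Measurable.aemeasurable (by fun_prop)

lemma setLIntegral_le_of_indicator {F : ℝ → ℝ≥0∞} {u v : ℝ} {c : ℝ≥0∞} {s : Set ℝ}
    (h : ∀ y, F y ≤ (Ioo u v).indicator (fun _ => c) y) :
    ∫⁻ y in s, F y ≤ c * ENNReal.ofReal (v - u) :=
  calc ∫⁻ y in s, F y ≤ ∫⁻ y in s, (Ioo u v).indicator (fun _ => c) y := lintegral_mono h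
    _ ≤ ∫⁻ y, (Ioo u v).indicator (fun _ => c) y := setLIntegral_le_lintegral _ _
    _ = c * ENNReal.ofReal (v - u) := by
      rw [lintegral_indicator measurableSet_Ioo, setLIntegral_const, Real.volume_Ioo]

lemma le_setLIntegral_of_Ioo {F : ℝ → ℝ≥0∞} {u v : ℝ} {c : ℝ≥0∞} {s : Set ℝ}
    (hs : Ioo u v ⊆ s) (h : ∀ y ∈ Ioo u v, c ≤ F y) :
    c * ENNReal.ofReal (v - u) ≤ ∫⁻ y in s, F y :=
  calc c * ENNReal.ofReal (v - u) = ∫⁻ _ in Ioo u v, c := by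
        rw [setLIntegral_const, Real.volume_Ioo]
    _ ≤ ∫⁻ y in Ioo u v, F y := setLIntegral_mono' measurableSet_Ioo h
    _ ≤ _ := lintegral_mono_set hs

/-- The squared modulus of the monomial `z₁ ^ a * z₂ ^ b`, as a function of the moduli. -/
def sqWeight (a b : ℕ) (r : ℝ × ℝ) : ℝ≥0∞ := ENNReal.ofReal (r.1 ^ (2 * a) * r.2 ^ (2 * b))

lemma measurable_sqWeight (a b : ℕ) : Measurable (sqWeight a b) := by
  unfold sqWeight; fun_prop

lemma measurableSet_reinhardt {S : Set (ℝ × ℝ)} (hS : MeasurableSet S) :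
    MeasurableSet (reinhardt S) :=
  hS.preimage (f := fun z : ℂ × ℂ => (‖z.1‖, ‖z.2‖)) (by fun_prop)

lemma setLIntegral_reinhardt {S : Set (ℝ × ℝ)} (hS : MeasurableSet S) (G : ℝ × ℝ → ℝ≥0∞) :
    ∫⁻ z in reinhardt S, G (‖z.1‖, ‖z.2‖) = ∫⁻ z : ℂ × ℂ, S.indicator G (‖z.1‖, ‖z.2‖) := by
  rw [← lintegral_indicator (measurableSet_reinhardt hS)]
  rfl

/-! ### Convergence and divergence on the core and the two cusps -/

lemma sqWeight_core_lt_top (a b : ℕ) :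
    ∫⁻ z in reinhardt shadowCore, sqWeight a b (‖z.1‖, ‖z.2‖) < ∞ := by
  have hms : MeasurableSet shadowCore := measurableSet_Ioo.prod measurableSet_Ioo
  have h1 : ∫⁻ z in reinhardt shadowCore, sqWeight a b (‖z.1‖, ‖z.2‖) ≤
      ∫⁻ _ in reinhardt shadowCore, ENNReal.ofReal (Real.exp 1 ^ (2 * a) * 2 ^ (2 * b)) := by
    refine setLIntegral_mono' (measurableSet_reinhardt hms) fun z hz => ?_
    unfold sqWeight
    have h2 : ‖z.1‖ ≤ Real.exp 1 := hz.1.2.le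
    have h3 : ‖z.2‖ ≤ 2 := hz.2.2.le
    gcongr
  refine h1.trans_lt ?_
  rw [setLIntegral_const]
  refine ENNReal.mul_lt_top ENNReal.ofReal_lt_top ?_
  refine (measure_mono (t := ball (0 : ℂ) (Real.exp 1) ×ˢ ball (0 : ℂ) 2)
    fun z hz => ?_).trans_lt ?_
  · exact ⟨mem_ball_zero_iff.2 hz.1.2, mem_ball_zero_iff.2 hz.2.2⟩
  · rw [Measure.volume_eq_prod, Measure.prod_prod]
    exact ENNReal.mul_lt_top measure_ball_lt_top measure_ball_lt_top

/-- The antiderivative `-1 / log x` has a finite limit at infinity. -/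
lemma integrableOn_inv_mul_log_sq :
    IntegrableOn (fun x : ℝ => 1 / (x * Real.log x ^ 2)) (Ioi 2) := by
  have hlog : ∀ x : ℝ, 2 ≤ x → 0 < Real.log x := fun x hx => Real.log_pos (by linarith)
  refine integrableOn_Ioi_deriv_of_nonneg' (g := fun x => -(Real.log x)⁻¹) (l := -0)
    (fun x hx => ?_) (fun x hx => ?_) ?_
  · have hx0 : (x : ℝ) ≠ 0 := by have := mem_Ici.1 hx; linarith
    have := ((Real.hasDerivAt_log hx0).inv (hlog x hx).ne').neg
    refine this.congr_deriv ?_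
    rw [neg_div, neg_neg, inv_eq_one_div, div_div]
  · have h1 := hlog x (le_of_lt hx)
    have h2 : 0 < x := by have := mem_Ioi.1 hx; linarith
    positivity
  · exact (tendsto_inv_atTop_zero.comp Real.tendsto_log_atTop).neg

lemma sqWeight_horizontal_lt_top {a b : ℕ} (hab : a ≤ b) :
    ∫⁻ z in reinhardt shadowHorizontal, sqWeight a b (‖z.1‖, ‖z.2‖) < ∞ := by
  have hms := isOpen_shadowHorizontal.measurableSet
  rw [setLIntegral_reinhardt hms,
    lintegral_comp_norms ((measurable_sqWeight a b).indicator hms)]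
  refine ENNReal.mul_lt_top (by finiteness) ?_
  have hl2 : 0 < Real.log 2 := Real.log_pos one_lt_two
  -- The fibre integral is at most supremum times length. Two of the `2b + 2` logarithms are kept
  -- for convergence in `x`; the others are bounded below by `log 2`.
  have key : ∀ x ∈ Ioi (0 : ℝ), ∫⁻ y in Ioi (0 : ℝ), ENNReal.ofReal (x * y) *
      shadowHorizontal.indicator (sqWeight a b) (x, y) ≤ (Ioi 2).indicator (fun x =>
        ENNReal.ofReal ((Real.log 2 ^ (2 * b))⁻¹ * (1 / (x * Real.log x ^ 2)))) x := by
    intro x hx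
    by_cases h2 : 2 < x
    swap
    · have : ∀ y, (x, y) ∉ shadowHorizontal := fun y hy => h2 hy.1
      simp [this, h2]
    have hx0 : (0 : ℝ) < x := hx
    rw [indicator_of_mem (mem_Ioi.2 h2)]
    set q := 1 / (x * Real.log x) with hq
    have hl : Real.log 2 ≤ Real.log x := Real.log_le_log two_pos h2.le
    have hlx : 0 < Real.log x := by linarith
    have hq0 : 0 < q := by positivity
    refine (setLIntegral_le_of_indicator (u := 0) (v := q)
      (c := ENNReal.ofReal (x ^ (2 * a + 1) * q ^ (2 * b + 1))) fun y => ?_).trans ?_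
    · by_cases hy : (x, y) ∈ shadowHorizontal
      · have hyq : y < q := by rw [hq, lt_div_iff₀ (by positivity)]; exact hy.2.2
        have hy0 : 0 < y := hy.2.1
        rw [indicator_of_mem hy, indicator_of_mem (show y ∈ Ioo 0 q from ⟨hy0, hyq⟩), sqWeight,
          ← ENNReal.ofReal_mul (by positivity)]
        refine ENNReal.ofReal_le_ofReal ?_
        calc x * y * (x ^ (2 * a) * y ^ (2 * b)) = x ^ (2 * a + 1) * y ^ (2 * b + 1) := by ring
          _ ≤ _ := by gcongr
      · rw [indicator_of_notMem hy, mul_zero]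
        exact zero_le
    · rw [← ENNReal.ofReal_mul (by positivity)]
      refine ENNReal.ofReal_le_ofReal ?_
      calc x ^ (2 * a + 1) * q ^ (2 * b + 1) * (q - 0)
          = x ^ (2 * a + 1) / (x ^ (2 * b + 2) * (Real.log x ^ 2 * Real.log x ^ (2 * b))) := by
            simp only [hq, div_pow, mul_pow, one_pow]; field_simp; ring
        _ ≤ x ^ (2 * b + 1) / (x ^ (2 * b + 2) * (Real.log x ^ 2 * Real.log 2 ^ (2 * b))) := by
            gcongr
            linarith
        _ = _ := by field_simp; ring
  refine (setLIntegral_mono' measurableSet_Ioi key).trans_lt ?_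
  rw [lintegral_indicator measurableSet_Ioi]
  refine lt_of_le_of_lt (lintegral_mono' (Measure.restrict_mono_measure Measure.restrict_le_self _)
    le_rfl) ?_
  exact (integrableOn_inv_mul_log_sq.const_mul _).lintegral_lt_top

lemma sqWeight_vertical_lt_top {m a b : ℕ} (hm : 1 ≤ m) (hab : 2 * b + 2 ≤ 2 * a + m) :
    ∫⁻ z in reinhardt (shadowVertical m), sqWeight a b (‖z.1‖, ‖z.2‖) < ∞ := by
  have hms := (isOpen_shadowVertical m).measurableSet
  rw [setLIntegral_reinhardt hms,
    lintegral_comp_norms_symm ((measurable_sqWeight a b).indicator hms)]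
  refine ENNReal.mul_lt_top (by finiteness) ?_
  -- Supremum times width again, with `x < 2 / y`; the exponent condition leaves at most a constant
  -- times `y ^ (-2)`.
  have key : ∀ y ∈ Ioi (0 : ℝ), ∫⁻ x in Ioi (0 : ℝ), ENNReal.ofReal (x * y) *
      (shadowVertical m).indicator (sqWeight a b) (x, y) ≤ (Ioi 1).indicator (fun y =>
        ENNReal.ofReal (2 ^ (2 * a + 2) * y ^ (-2 : ℝ))) y := by
    intro y hy
    by_cases h2 : 1 < y
    swap
    · have : ∀ x, (x, y) ∉ shadowVertical m := fun x hx => h2 hx.1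
      simp [this, h2]
    have hy0 : (0 : ℝ) < y := hy
    rw [indicator_of_mem (mem_Ioi.2 h2)]
    refine (setLIntegral_le_of_indicator (u := 1 / y - 1 / y ^ m) (v := 1 / y + 1 / y ^ m)
      (c := ENNReal.ofReal ((2 / y) ^ (2 * a + 1) * y ^ (2 * b + 1))) fun x => ?_).trans ?_
    · by_cases hx : (x, y) ∈ shadowVertical m
      · obtain ⟨hx0, hx1⟩ := shadowVertical_bounds hm hx
        have hx2 := abs_lt.1 hx.2
        dsimp only at hx0 hx1 hx2
        rw [indicator_of_mem hx, indicator_of_mem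
          (show x ∈ Ioo (1 / y - 1 / y ^ m) (1 / y + 1 / y ^ m) from ⟨by linarith, by linarith⟩),
          sqWeight,
          ← ENNReal.ofReal_mul (by positivity)]
        refine ENNReal.ofReal_le_ofReal ?_
        calc x * y * (x ^ (2 * a) * y ^ (2 * b)) = x ^ (2 * a + 1) * y ^ (2 * b + 1) := by ring
          _ ≤ _ := by gcongr
      · rw [indicator_of_notMem hx, mul_zero]
        exact zero_le
    · rw [← ENNReal.ofReal_mul (by positivity)]
      refine ENNReal.ofReal_le_ofReal ?_
      have hp : y ^ (2 * b + 3) ≤ y ^ (2 * a + 1 + m) := pow_le_pow_right₀ h2.le (by omega)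
      rw [Real.rpow_neg hy0.le, Real.rpow_ofNat]
      calc (2 / y) ^ (2 * a + 1) * y ^ (2 * b + 1) * (1 / y + 1 / y ^ m - (1 / y - 1 / y ^ m))
          = 2 ^ (2 * a + 2) * (y ^ (2 * b + 3) / y ^ (2 * a + 1 + m)) * (y ^ 2)⁻¹ := by
            rw [div_pow]; field_simp; ring
        _ ≤ 2 ^ (2 * a + 2) * 1 * (y ^ 2)⁻¹ := by
            gcongr
            rw [div_le_one (by positivity)]; exact hp
        _ = _ := by ring
  refine (setLIntegral_mono' measurableSet_Ioi key).trans_lt ?_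
  rw [lintegral_indicator measurableSet_Ioi]
  refine lt_of_le_of_lt (lintegral_mono' (Measure.restrict_mono_measure Measure.restrict_le_self _)
    le_rfl) ?_
  exact ((integrableOn_Ioi_rpow_of_lt (by norm_num) one_pos).const_mul _).lintegral_lt_top

lemma sqWeight_horizontal_eq_top {a b : ℕ} (hab : b < a) :
    ∫⁻ z in reinhardt shadowHorizontal, sqWeight a b (‖z.1‖, ‖z.2‖) = ∞ := by
  have hms := isOpen_shadowHorizontal.measurableSet
  rw [setLIntegral_reinhardt hms,
    lintegral_comp_norms ((measurable_sqWeight a b).indicator hms)]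
  refine ENNReal.mul_eq_top.2 (Or.inl ⟨by simp [Real.pi_pos], ?_⟩)
  have hlo : ∀ᶠ x : ℝ in atTop, Real.log x ^ (2 * b + 2) ≤ x := by
    filter_upwards [(Real.isLittleO_pow_log_id_atTop (n := 2 * b + 2)).bound one_pos,
      eventually_gt_atTop 1] with x hx h1
    have h2 := Real.log_pos h1
    rw [Real.norm_of_nonneg (by positivity)] at hx
    simpa [abs_of_pos (by linarith : 0 < x)] using hx
  obtain ⟨N, hN⟩ := eventually_atTop.1 (hlo.and (eventually_gt_atTop 2))
  -- On the upper half of the fibre `y` is comparable to `q`. Since `b < a`, the spare power of `x`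
  -- beats the logarithms for large `x`, so the fibre integrals stay above a constant.
  have key : ∀ x ∈ Ioi N, ENNReal.ofReal ((2 ^ (2 * b + 2))⁻¹) ≤
      ∫⁻ y in Ioi (0 : ℝ), ENNReal.ofReal (x * y) *
        shadowHorizontal.indicator (sqWeight a b) (x, y) := by
    intro x hx
    obtain ⟨h1, h2⟩ := hN x (le_of_lt hx)
    have hx0 : 0 < x := by linarith
    have hlx : 0 < Real.log x := Real.log_pos (by linarith)
    set q := 1 / (x * Real.log x) with hq
    have hq0 : 0 < q := by positivity
    refine le_trans ?_ (le_setLIntegral_of_Ioo (u := q / 2) (v := q)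
      (c := ENNReal.ofReal (x ^ (2 * a + 1) * (q / 2) ^ (2 * b + 1)))
      (fun y hy => lt_trans (half_pos hq0) hy.1) fun y hy => ?_)
    · rw [← ENNReal.ofReal_mul (by positivity)]
      refine ENNReal.ofReal_le_ofReal ?_
      have hp : x ^ (2 * b + 3) ≤ x ^ (2 * a + 1) := pow_le_pow_right₀ (by linarith) (by omega)
      calc ((2 : ℝ) ^ (2 * b + 2))⁻¹ = (2 ^ (2 * b + 2))⁻¹ * 1 := by ring
        _ ≤ (2 ^ (2 * b + 2))⁻¹ * (x ^ (2 * a + 1) / (x ^ (2 * b + 2) *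
            Real.log x ^ (2 * b + 2))) := by
            gcongr
            rw [one_le_div (by positivity)]
            calc x ^ (2 * b + 2) * Real.log x ^ (2 * b + 2) ≤ x ^ (2 * b + 2) * x := by gcongr
              _ = x ^ (2 * b + 3) := by ring
              _ ≤ _ := hp
        _ = _ := by simp only [hq, div_pow, mul_pow, one_pow]; field_simp; ring
    · have hy0 : 0 < y := lt_trans (half_pos hq0) hy.1
      have hmem : (x, y) ∈ shadowHorizontal := by
        refine ⟨h2, hy0, ?_⟩
        have := hy.2
        rwa [hq, lt_div_iff₀ (by positivity)] at this
      rw [indicator_of_mem hmem, sqWeight, ← ENNReal.ofReal_mul (by positivity)]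
      refine ENNReal.ofReal_le_ofReal ?_
      have := hy.1.le
      calc _ ≤ x ^ (2 * a + 1) * y ^ (2 * b + 1) := by gcongr
        _ = x * y * (x ^ (2 * a) * y ^ (2 * b)) := by ring
  have hN2 : 0 < N := by linarith [(hN N le_rfl).2]
  rw [eq_top_iff]
  refine le_trans ?_ (lintegral_mono_set (Ioi_subset_Ioi hN2.le))
  refine le_trans ?_ (setLIntegral_mono' measurableSet_Ioi key)
  rw [setLIntegral_const, Real.volume_Ioi, ENNReal.mul_top (by simp)]

lemma sqWeight_vertical_eq_top {m a b : ℕ} (hab : 2 * a + m < 2 * b + 2) :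
    ∫⁻ z in reinhardt (shadowVertical m), sqWeight a b (‖z.1‖, ‖z.2‖) = ∞ := by
  have hms := (isOpen_shadowVertical m).measurableSet
  rw [setLIntegral_reinhardt hms,
    lintegral_comp_norms_symm ((measurable_sqWeight a b).indicator hms)]
  refine ENNReal.mul_eq_top.2 (Or.inl ⟨by simp [Real.pi_pos], ?_⟩)
  -- The half of the fibre with `x > 1 / y` already contributes at least `1 / y`, which is not
  -- integrable at infinity.
  have key : ∀ y ∈ Ioi (1 : ℝ), ENNReal.ofReal y⁻¹ ≤ ∫⁻ x in Ioi (0 : ℝ), ENNReal.ofReal (x * y) *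
      (shadowVertical m).indicator (sqWeight a b) (x, y) := by
    intro y hy
    have hy1 : 1 < y := hy
    have hy0 : 0 < y := by linarith
    have h1y : 0 < 1 / y := by positivity
    refine le_trans ?_ (le_setLIntegral_of_Ioo (u := 1 / y) (v := 1 / y + 1 / y ^ m)
      (c := ENNReal.ofReal ((1 / y) ^ (2 * a + 1) * y ^ (2 * b + 1)))
      (fun x hx => lt_trans h1y hx.1) fun x hx => ?_)
    · rw [← ENNReal.ofReal_mul (by positivity)]
      refine ENNReal.ofReal_le_ofReal ?_
      have hp : y ^ (2 * a + 1 + m) ≤ y ^ (2 * b + 2) := pow_le_pow_right₀ hy1.le (by omega)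
      calc y⁻¹ = y⁻¹ * 1 := by ring
        _ ≤ y⁻¹ * (y ^ (2 * b + 2) / y ^ (2 * a + 1 + m)) := by
            gcongr
            rw [one_le_div (by positivity)]; exact hp
        _ = _ := by rw [div_pow, one_pow]; field_simp; ring
    · have hx0 : 0 < x := lt_trans h1y hx.1
      have hmem : (x, y) ∈ shadowVertical m := by
        refine ⟨hy1, abs_lt.2 ⟨?_, ?_⟩⟩
        · have : 0 < 1 / y ^ m := by positivity
          dsimp only; linarith [hx.1]
        · dsimp only; linarith [hx.2]
      rw [indicator_of_mem hmem, sqWeight, ← ENNReal.ofReal_mul (by positivity)]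
      refine ENNReal.ofReal_le_ofReal ?_
      have := hx.1.le
      calc _ ≤ x ^ (2 * a + 1) * y ^ (2 * b + 1) := by gcongr
        _ = x * y * (x ^ (2 * a) * y ^ (2 * b)) := by ring
  rw [eq_top_iff]
  refine le_trans ?_ (lintegral_mono_set (Ioi_subset_Ioi zero_le_one))
  refine le_trans ?_ (setLIntegral_mono' measurableSet_Ioi key)
  by_contra hlt
  refine not_integrableOn_Ioi_inv (a := 1) ⟨by fun_prop, ?_⟩
  rw [hasFiniteIntegral_iff_ofReal]
  · exact lt_of_not_ge hlt
  · filter_upwards [ae_restrict_mem measurableSet_Ioi] with y hy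
    have : 1 < y := hy
    simp only [Pi.zero_apply]
    positivity

lemma sqWeight_lt_top_iff {m : ℕ} (hm : 1 ≤ m) (a b : ℕ) :
    ∫⁻ z in reinhardt (shadow m), sqWeight a b (‖z.1‖, ‖z.2‖) < ∞ ↔
      a ≤ b ∧ 2 * b + 2 ≤ 2 * a + m := by
  constructor
  · intro h
    constructor
    · by_contra! hab
      refine absurd (sqWeight_horizontal_eq_top hab) (ne_of_lt (lt_of_le_of_lt ?_ h))
      exact lintegral_mono_set fun z hz => Or.inl (Or.inr hz)
    · by_contra! hab
      refine absurd (sqWeight_vertical_eq_top hab) (ne_of_lt (lt_of_le_of_lt ?_ h))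
      exact lintegral_mono_set fun z hz => Or.inr hz
  · rintro ⟨h1, h2⟩
    refine (lintegral_union_le _ (reinhardt (shadowCore ∪ shadowHorizontal))
      (reinhardt (shadowVertical m))).trans_lt (ENNReal.add_lt_top.2
        ⟨?_, sqWeight_vertical_lt_top hm h2⟩)
    exact (lintegral_union_le _ (reinhardt shadowCore) (reinhardt shadowHorizontal)).trans_lt
      (ENNReal.add_lt_top.2 ⟨sqWeight_core_lt_top a b, sqWeight_horizontal_lt_top h1⟩)

lemma volume_Omega_lt_top {m : ℕ} (hm : 2 ≤ m) : volume (Omega m : Set (ℂ × ℂ)) < ∞ := by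
  have h := (sqWeight_lt_top_iff (m := m) (by omega) 0 0).2 ⟨le_rfl, by omega⟩
  rw [← restrict_Omega] at h
  simpa [sqWeight] using h

/-! ### Laurent coefficients of square integrable holomorphic functions -/

lemma measurePreserving_unit_mul (s : ℝ) : MeasurePreserving (fun z : ℂ => unit s * z) := by
  have := (rotation (Circle.exp s)).measurePreserving
  convert this using 2
  simp [unit, rotation_apply]

lemma measurePreserving_rot {S : Set (ℝ × ℝ)} (hS : MeasurableSet S) (τ : ℝ × ℝ) :
    MeasurePreserving (rot τ) (volume.restrict (reinhardt S)) (volume.restrict (reinhardt S)) := by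
  have h : MeasurePreserving (rot τ) volume volume :=
    (measurePreserving_unit_mul τ.1).prod (measurePreserving_unit_mul τ.2)
  have h2 := h.restrict_preimage (measurableSet_reinhardt hS)
  have h3 : rot τ ⁻¹' reinhardt S = reinhardt S := by
    ext z; exact rot_mem_reinhardt τ
  rwa [h3] at h2

/-- Lebesgue measure on the pairs of angles. -/
abbrev torusMeasure : Measure (ℝ × ℝ) := angleMeasure.prod angleMeasure

/-- Transfers integrability and measurability of `k` to `(τ, z) ↦ k (rot τ z)`, as Fubini requires
when averaging over rotations. -/
lemma measurePreserving_skew_rot {S : Set (ℝ × ℝ)} (hS : MeasurableSet S) :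
    MeasurePreserving (fun p : (ℝ × ℝ) × (ℂ × ℂ) => (p.1, rot p.1 p.2))
      (torusMeasure.prod (volume.restrict (reinhardt S)))
      (torusMeasure.prod (volume.restrict (reinhardt S))) :=
  (MeasurePreserving.id torusMeasure).skew_product (g := rot) continuous_rot.measurable
    (Eventually.of_forall fun τ => (measurePreserving_rot hS τ).map_eq)

lemma integral_torusMean {S : Set (ℝ × ℝ)} (hS : MeasurableSet S) {k : ℂ × ℂ → ℂ}
    (hk : IntegrableOn k (reinhardt S)) :
    ∫ z in reinhardt S, torusMean k z = torusMeasure.real univ • ∫ z in reinhardt S, k z := by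
  have hint : Integrable (fun p : (ℝ × ℝ) × (ℂ × ℂ) => k (rot p.1 p.2))
      (torusMeasure.prod (volume.restrict (reinhardt S))) :=
    (measurePreserving_skew_rot hS).integrable_comp_of_integrable 
      (g := fun p : (ℝ × ℝ) × (ℂ × ℂ) => k p.2) (hk.comp_snd torusMeasure)
  unfold torusMean
  rw [← integral_integral_swap (f := fun τ z => k (rot τ z)) hint]
  have : ∀ τ, ∫ z in reinhardt S, k (rot τ z) = ∫ z in reinhardt S, k z := fun τ => by
    have hmp := measurePreserving_rot hS τ
    rw [← integral_map (f := k) hmp.measurable.aemeasurable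
      (by rw [hmp.map_eq]; exact hk.aestronglyMeasurable), hmp.map_eq]
  simp only [this, integral_const]

lemma lintegral_sq_le {α : Type*} [MeasurableSpace α] {μ : Measure α} {u : α → ℝ≥0∞}
    (hu : AEMeasurable u μ) : (∫⁻ x, u x ∂μ) ^ 2 ≤ μ univ * ∫⁻ x, u x ^ 2 ∂μ := by
  have h := ENNReal.lintegral_mul_le_Lp_mul_Lq μ Real.HolderConjugate.two_two
    (aemeasurable_const (b := (1 : ℝ≥0∞))) hu
  simp only [Pi.mul_apply, one_mul, ENNReal.one_rpow, lintegral_const] at h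
  calc (∫⁻ x, u x ∂μ) ^ 2
      ≤ (μ univ ^ (1 / 2 : ℝ) * (∫⁻ x, u x ^ (2 : ℝ) ∂μ) ^ (1 / 2 : ℝ)) ^ 2 := by gcongr
    _ = _ := by
      rw [mul_pow, ← ENNReal.rpow_natCast, ← ENNReal.rpow_mul, ← ENNReal.rpow_natCast,
        ← ENNReal.rpow_mul]
      norm_num

/-- The product of `g` and the monomial `z₁ ^ (-a) * z₂ ^ (-b)`, whose torus integrals are the
Laurent coefficients of `g`. -/
def laurentKernel (g : ℂ × ℂ → ℂ) (a b : ℤ) (z : ℂ × ℂ) : ℂ := g z * (z.1 ^ (-a) * z.2 ^ (-b))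

lemma reinhardt_ne_zero {S : Set (ℝ × ℝ)} (hpos : ∀ r ∈ S, 0 < r.1 ∧ 0 < r.2) {z : ℂ × ℂ}
    (hz : z ∈ reinhardt S) : z.1 ≠ 0 ∧ z.2 ≠ 0 :=
  ⟨norm_pos_iff.1 (hpos _ hz).1, norm_pos_iff.1 (hpos _ hz).2⟩

lemma differentiableOn_laurentKernel {S : Set (ℝ × ℝ)} (hpos : ∀ r ∈ S, 0 < r.1 ∧ 0 < r.2)
    {g : ℂ × ℂ → ℂ} (hg : DifferentiableOn ℂ g (reinhardt S)) (a b : ℤ) :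
    DifferentiableOn ℂ (laurentKernel g a b) (reinhardt S) :=
  hg.mul ((differentiableOn_fst.zpow (Or.inl fun _ hz => (reinhardt_ne_zero hpos hz).1)).mul
    (differentiableOn_snd.zpow (Or.inl fun _ hz => (reinhardt_ne_zero hpos hz).2)))

lemma laurentKernel_rot (g : ℂ × ℂ → ℂ) (a b : ℤ) (τ : ℝ × ℝ) (z : ℂ × ℂ) :
    laurentKernel g a b (rot τ z) =
      (unit τ.1 ^ (-a) * unit τ.2 ^ (-b) * g (rot τ z)) * (z.1 ^ (-a) * z.2 ^ (-b)) := by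
  simp only [laurentKernel, rot, mul_zpow]
  ring

/-- Links the two descriptions of a Laurent term: coefficient times monomial is, up to
normalisation, a Fourier coefficient of `g` on the torus through `z`. -/
lemma torusMean_laurentKernel_mul (g : ℂ × ℂ → ℂ) (a b : ℤ) {z : ℂ × ℂ} (h₁ : z.1 ≠ 0)
    (h₂ : z.2 ≠ 0) : torusMean (laurentKernel g a b) z * (z.1 ^ a * z.2 ^ b) =
      ∫ τ, unit τ.1 ^ (-a) * unit τ.2 ^ (-b) * g (rot τ z) ∂torusMeasure := by
  simp only [torusMean, laurentKernel_rot]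
  rw [integral_mul_const, mul_assoc]
  have : z.1 ^ (-a) * z.2 ^ (-b) * (z.1 ^ a * z.2 ^ b) = 1 := by
    rw [zpow_neg, zpow_neg]
    have := zpow_ne_zero a h₁
    have := zpow_ne_zero b h₂
    field_simp
  rw [this, mul_one]

/-- A square integrable function has vanishing Laurent coefficients along the monomials that are not
square integrable. -/
lemma sqWeight_lt_top_of_torusMean_ne_zero {S : Set (ℝ × ℝ)} (hS : MeasurableSet S)
    (hpos : ∀ r ∈ S, 0 < r.1 ∧ 0 < r.2) {g : ℂ × ℂ → ℂ}
    (hgc : ContinuousOn g (reinhardt S)) (hg : MemLp g 2 (volume.restrict (reinhardt S)))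
    {a b : ℕ} {C : ℂ} (hC : C ≠ 0)
    (h : ∀ z ∈ reinhardt S, torusMean (laurentKernel g a b) z = C) :
    ∫⁻ z in reinhardt S, sqWeight a b (‖z.1‖, ‖z.2‖) < ∞ := by
  set μ := (volume : Measure (ℂ × ℂ)).restrict (reinhardt S)
  have hmeas : AEStronglyMeasurable (fun p : (ℝ × ℝ) × (ℂ × ℂ) => g (rot p.1 p.2))
      (torusMeasure.prod μ) :=
    (hg.aestronglyMeasurable.comp_snd (μ := torusMeasure)).comp_measurePreserving
      (measurePreserving_skew_rot hS)
  have hswap : ∫⁻ z, ∫⁻ τ, ‖g (rot τ z)‖ₑ ^ 2 ∂torusMeasure ∂μ =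
      torusMeasure univ * ∫⁻ z, ‖g z‖ₑ ^ 2 ∂μ := by
    rw [← lintegral_lintegral_swap (f := fun τ z => ‖g (rot τ z)‖ₑ ^ 2) (hmeas.enorm.pow_const 2)]
    have : ∀ τ, ∫⁻ z, ‖g (rot τ z)‖ₑ ^ 2 ∂μ = ∫⁻ z, ‖g z‖ₑ ^ 2 ∂μ := fun τ => by
      have hmp := measurePreserving_rot hS τ
      rw [← lintegral_map' (f := fun z => ‖g z‖ₑ ^ 2)
        (by rw [hmp.map_eq]; exact hg.aestronglyMeasurable.enorm.pow_const 2)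
        hmp.measurable.aemeasurable, hmp.map_eq]
    simp only [this, lintegral_const, mul_comm]
  have hfin : ∫⁻ z, ‖g z‖ₑ ^ 2 ∂μ < ∞ := by
    have := (eLpNorm_lt_top_iff_lintegral_rpow_enorm_lt_top (by norm_num) (by norm_num)).1 hg.2
    simpa using this
  -- Cauchy–Schwarz on each torus bounds the Laurent term by the mean square of `g` there;
  -- integrated over all tori, the right side is a multiple of the squared norm of `g`.
  have hle : ∫⁻ z, ‖C‖ₑ ^ 2 * sqWeight a b (‖z.1‖, ‖z.2‖) ∂μ ≤
      ∫⁻ z, torusMeasure univ * ∫⁻ τ, ‖g (rot τ z)‖ₑ ^ 2 ∂torusMeasure ∂μ := by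
    refine lintegral_mono_ae ?_
    filter_upwards [ae_restrict_mem (measurableSet_reinhardt hS)] with z hz
    have hz1 : AEMeasurable (fun τ => ‖g (rot τ z)‖ₑ) torusMeasure :=
      (continuous_comp_rot hgc hz).enorm.measurable.aemeasurable
    obtain ⟨h₁, h₂⟩ := reinhardt_ne_zero hpos hz
    refine le_trans ?_ (lintegral_sq_le hz1)
    have h3 := torusMean_laurentKernel_mul g a b h₁ h₂
    rw [h z hz] at h3
    have h4 : ‖C‖ₑ ^ 2 * sqWeight a b (‖z.1‖, ‖z.2‖) =
        ‖C * (z.1 ^ (a : ℤ) * z.2 ^ (b : ℤ))‖ₑ ^ 2 := by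
      rw [enorm_mul, mul_pow, sqWeight, zpow_natCast, zpow_natCast, ← ofReal_norm (_ * _),
        ← ENNReal.ofReal_pow (norm_nonneg _), norm_mul, norm_pow, norm_pow]
      congr 2
      ring
    rw [h4, h3]
    gcongr
    refine (enorm_integral_le_lintegral_enorm _).trans (le_of_eq ?_)
    congr 1; ext τ
    rw [← ofReal_norm, ← ofReal_norm, norm_mul, norm_mul, norm_zpow, norm_zpow]
    simp
  have hT : torusMeasure univ < ∞ := measure_lt_top _ _
  rw [lintegral_const_mul' _ _ (by finiteness), lintegral_const_mul' _ _ hT.ne, hswap] at hle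
  have h5 := hle.trans_lt (ENNReal.mul_lt_top hT (ENNReal.mul_lt_top hT hfin))
  by_contra h6
  rw [not_lt_top_iff.1 h6, ENNReal.mul_top (by simpa using hC)] at h5
  exact lt_irrefl _ h5

lemma setIntegral_pos {α : Type*} [MeasurableSpace α] {μ : Measure α} {s : Set α} {F : α → ℝ}
    (hs : MeasurableSet s) (hμ : μ s ≠ 0) (hF : IntegrableOn F s μ) (h : ∀ z ∈ s, 0 < F z) :
    0 < ∫ z in s, F z ∂μ := by
  rw [setIntegral_pos_iff_support_of_nonneg_ae _ hF]
  · have hsub : s ⊆ Function.support F := fun z hz => (h z hz).ne'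
    rw [inter_eq_right.2 hsub]
    exact pos_iff_ne_zero.2 hμ
  · filter_upwards [ae_restrict_mem hs] with z hz using (h z hz).le

/-- A function on a Reinhardt domain without Laurent coefficients vanishes. -/
lemma eq_zero_of_torusMean_eq_zero {S : Set (ℝ × ℝ)} (hpos : ∀ r ∈ S, 0 < r.1 ∧ 0 < r.2)
    {g : ℂ × ℂ → ℂ} (hg : ContinuousOn g (reinhardt S)) {z : ℂ × ℂ} (hz : z ∈ reinhardt S)
    (h : ∀ a b : ℤ, torusMean (laurentKernel g a b) z = 0) : g z = 0 := by
  obtain ⟨h₁, h₂⟩ := reinhardt_ne_zero hpos hz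
  have hc : Continuous fun τ => g (rot τ z) := continuous_comp_rot hg hz
  have hu : ∀ n : ℤ, Continuous fun s => unit s ^ n := fun n =>
    continuous_unit.zpow₀ n fun s => Or.inl (unit_ne_zero s)
  have h0 : ∀ a b : ℤ, ∫ t, unit t ^ b * ∫ s, unit s ^ a * g (rot (s, t) z)
      ∂angleMeasure ∂angleMeasure = 0 := by
    intro a b
    have h3 := torusMean_laurentKernel_mul g (-a) (-b) h₁ h₂
    rw [h, zero_mul, neg_neg, neg_neg, integral_prod_symm] at h3
    · rw [h3]
      congr 1; ext t
      rw [← integral_const_mul]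
      congr 1; ext s
      ring
    · exact integrable_angleMeasure_prod
        ((((hu a).comp continuous_fst).mul ((hu b).comp continuous_snd)).mul hc)
  -- Uniqueness is applied one angle at a time: to the partial coefficients as functions of `t`,
  -- then to `g` itself as a function of `s`.
  have h1 : ∀ (a : ℤ) (t : ℝ), ∫ s, unit s ^ a * g (rot (s, t) z) ∂angleMeasure = 0 := by
    intro a
    refine fourier_uniqueness ?_ ?_ (h0 a)
    · simp only [integral_angleMeasure]
      refine intervalIntegral.continuous_parametric_intervalIntegral_of_continuous'
        (f := fun t s => unit s ^ a * g (rot (s, t) z)) ?_ _ _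
      exact ((hu a).comp continuous_snd).mul (hc.comp continuous_swap)
    · intro t
      simp only [rot, unit_periodic t]
  have h2 : ∀ s t, g (rot (s, t) z) = 0 := by
    intro s t
    refine fourier_uniqueness (F := fun s => g (rot (s, t) z)) (hc.comp (by fun_prop)) ?_
      (fun n => h1 n t) s
    intro s
    simp only [rot, unit_periodic s]
  have := h2 0 0
  simpa [rot, unit] using this

lemma mem_Omega_of_bidisc (m : ℕ) {z : ℂ × ℂ} (h₁ : ‖z.1‖ < 2) (h₂ : ‖z.2‖ < 2) :
    z ∈ (Omega m : Set (ℂ × ℂ)) := by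
  refine interior_maximal (s := X ∪ Y m ∪ Z) (t := {z | ‖z.1‖ < 2 ∧ ‖z.2‖ < 2}) ?_ ?_ ⟨h₁, h₂⟩
  · rintro z ⟨h₁, h₂⟩
    exact Or.inr ⟨h₁.le.trans two_lt_exp_one.le, h₂.le⟩
  · exact (isOpen_lt continuous_fst.norm continuous_const).inter
      (isOpen_lt continuous_snd.norm continuous_const)

lemma one_mem_reinhardt_shadow (m : ℕ) : ((1, 1) : ℂ × ℂ) ∈ reinhardt (shadow m) := by
  refine Or.inl (Or.inl ⟨⟨?_, ?_⟩, ?_, ?_⟩) <;> norm_num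

/-- The integrand is holomorphic on the disc and vanishes at its centre. -/
lemma circleMean_mul_zpow_eq_zero {f : ℂ → ℂ} (hf : DifferentiableOn ℂ f (ball 0 2)) {n : ℤ}
    (hn : 0 < n) : circleMean (fun x => f x * x ^ n) 1 = 0 := by
  obtain ⟨k, rfl⟩ := Int.eq_ofNat_of_zero_le hn.le
  have hk : k ≠ 0 := by rintro rfl; simp at hn
  rw [circleMean_eq_center (R := 2) (by norm_num)]
  · simp [hk]
  · simp only [zpow_natCast]
    exact hf.mul (by fun_prop)

/-- Functions holomorphic on `Ω_m` have no Laurent coefficients with a negative exponent. -/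
lemma torusMean_eq_zero_of_neg {m : ℕ} (hm : 1 ≤ m) {g : ℂ × ℂ → ℂ}
    (hg : DifferentiableOn ℂ g (Omega m : Set (ℂ × ℂ))) {a b : ℤ} (hab : a < 0 ∨ b < 0)
    {z : ℂ × ℂ} (hz : z ∈ reinhardt (shadow m)) : torusMean (laurentKernel g a b) z = 0 := by
  have hd := differentiableOn_laurentKernel (shadow_pos hm)
    (hg.mono (reinhardt_shadow_subset m)) a b
  have h1 := one_mem_reinhardt_shadow m
  -- Moving to the unit torus puts the whole coordinate disc, axis included, inside `Ω_m`.
  rw [torusMean_eq (isOpen_shadow m) (shadow_pos hm) (isPreconnected_shadow m) hd hz h1]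
  rcases hab with ha | hb
  · rw [torusMean_eq_snd_fst hd.continuousOn h1]
    refine integral_eq_zero_of_ae (Eventually.of_forall fun t => ?_)
    simp only [laurentKernel, mul_one, Pi.zero_apply]
    have : ∀ x : ℂ, g (x, unit t) * (x ^ (-a) * unit t ^ (-b)) =
        g (x, unit t) * unit t ^ (-b) * x ^ (-a) := fun x => by ring
    simp only [this]
    refine circleMean_mul_zpow_eq_zero (f := fun x => g (x, unit t) * unit t ^ (-b)) ?_ (by omega)
    refine DifferentiableOn.mul_const ?_ _
    refine hg.comp (f := fun x => (x, unit t)) (by fun_prop) fun x hx => ?_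
    exact mem_Omega_of_bidisc m (mem_ball_zero_iff.1 hx) (by simp)
  · rw [torusMean_eq_fst_snd hd.continuousOn h1]
    refine integral_eq_zero_of_ae (Eventually.of_forall fun t => ?_)
    simp only [laurentKernel, mul_one, Pi.zero_apply, ← mul_assoc]
    refine circleMean_mul_zpow_eq_zero (f := fun x => g (unit t, x) * unit t ^ (-a)) ?_ (by omega)
    refine DifferentiableOn.mul_const ?_ _
    refine hg.comp (f := fun x => (unit t, x)) (by fun_prop) fun x hx => ?_
    exact mem_Omega_of_bidisc m (by simp) (mem_ball_zero_iff.1 hx)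

/-! ### Totality of the square integrable monomials -/

/-- The monomial `z₁ ^ a * z₂ ^ b`. -/
def monomial (a b : ℕ) (z : ℂ × ℂ) : ℂ := z.1 ^ a * z.2 ^ b

lemma continuous_monomial (a b : ℕ) : Continuous (monomial a b) := by unfold monomial; fun_prop

lemma enorm_monomial_sq (a b : ℕ) (z : ℂ × ℂ) :
    ‖monomial a b z‖ₑ ^ 2 = sqWeight a b (‖z.1‖, ‖z.2‖) := by
  rw [sqWeight, monomial, ← ofReal_norm, ← ENNReal.ofReal_pow (norm_nonneg _), norm_mul,
    norm_pow, norm_pow]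
  congr 1
  ring

lemma memLp_monomial_iff {m : ℕ} (hm : 1 ≤ m) (a b : ℕ) :
    MemLp (monomial a b) 2 (volume.restrict (reinhardt (shadow m))) ↔
      a ≤ b ∧ 2 * b + 2 ≤ 2 * a + m := by
  rw [← sqWeight_lt_top_iff hm, MemLp, and_iff_right (continuous_monomial a b).aestronglyMeasurable,
    eLpNorm_lt_top_iff_lintegral_rpow_enorm_lt_top (by norm_num) (by norm_num)]
  simp [enorm_monomial_sq]

/-- A square integrable holomorphic function on `Ω_m` that is orthogonal to all square integrable
monomials vanishes. -/
lemma eq_zero_of_orthogonal {m : ℕ} (hm : 1 ≤ m) {g : ℂ × ℂ → ℂ}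
    (hg : DifferentiableOn ℂ g (Omega m : Set (ℂ × ℂ)))
    (hg2 : MemLp g 2 (volume.restrict (reinhardt (shadow m))))
    (horth : ∀ a b : ℕ, a ≤ b → 2 * b + 2 ≤ 2 * a + m →
      ∫ z in reinhardt (shadow m), g z * (starRingEnd ℂ) (monomial a b z) = 0)
    {z : ℂ × ℂ} (hz : z ∈ reinhardt (shadow m)) : g z = 0 := by
  have hS := (isOpen_shadow m).measurableSet
  have hV := measurableSet_reinhardt hS
  have hgV := hg.mono (reinhardt_shadow_subset m)
  refine eq_zero_of_torusMean_eq_zero (shadow_pos hm) hgV.continuousOn hz fun a b => ?_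
  by_cases hab : a < 0 ∨ b < 0
  · exact torusMean_eq_zero_of_neg hm hg hab hz
  push Not at hab
  obtain ⟨a, rfl⟩ := Int.eq_ofNat_of_zero_le hab.1
  obtain ⟨b, rfl⟩ := Int.eq_ofNat_of_zero_le hab.2
  have hconst : ∀ w ∈ reinhardt (shadow m), torusMean (laurentKernel g a b) w =
      torusMean (laurentKernel g a b) z := fun w hw =>
    torusMean_eq (isOpen_shadow m) (shadow_pos hm) (isPreconnected_shadow m)
      (differentiableOn_laurentKernel (shadow_pos hm) hgV a b) hw hz
  set C := torusMean (laurentKernel g a b) z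
  by_contra hC
  have hlt := sqWeight_lt_top_of_torusMean_ne_zero hS (shadow_pos hm) hgV.continuousOn hg2 hC hconst
  rw [sqWeight_lt_top_iff hm] at hlt
  have hmon := (memLp_monomial_iff hm a b).2 hlt
  have hk : IntegrableOn (fun w => g w * (starRingEnd ℂ) (monomial a b w))
      (reinhardt (shadow m)) := hg2.integrable_mul hmon.star
  have h1 := integral_torusMean hS hk
  rw [horth a b hlt.1 hlt.2, smul_zero] at h1
  -- The conjugate of a monomial is its inverse times its squared modulus, which is constant on
  -- tori. Averaging thus turns the inner product into `C` times the squared norm of the monomial,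
  -- and orthogonality forces `C = 0`.
  have h2 : ∀ w ∈ reinhardt (shadow m),
      torusMean (fun w => g w * (starRingEnd ℂ) (monomial a b w)) w =
        C * ((‖monomial a b w‖ ^ 2 : ℝ) : ℂ) := by
    intro w hw
    rw [← hconst w hw, torusMean, torusMean, ← integral_mul_const]
    congr 1; ext τ
    obtain ⟨h₁, h₂⟩ := reinhardt_ne_zero (shadow_pos hm) ((rot_mem_reinhardt τ).2 hw)
    have h3 : ‖monomial a b w‖ = ‖monomial a b (rot τ w)‖ := by simp [monomial, rot]
    have h4 : monomial a b (rot τ w) ≠ 0 := mul_ne_zero (pow_ne_zero _ h₁) (pow_ne_zero _ h₂)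
    have h5 : laurentKernel g a b (rot τ w) = g (rot τ w) * (monomial a b (rot τ w))⁻¹ := by
      simp [laurentKernel, monomial, mul_comm]
    rw [h3, h5]
    push_cast
    rw [← Complex.mul_conj']
    field_simp
  rw [setIntegral_congr_fun hV h2, integral_const_mul, integral_complex_ofReal, mul_eq_zero,
    Complex.ofReal_eq_zero] at h1
  refine h1.elim hC (ne_of_gt (setIntegral_pos hV ?_ ?_ ?_))
  · exact ((isOpen_reinhardt (isOpen_shadow m)).measure_pos volume ⟨z, hz⟩).ne'
  · exact hmon.norm.integrable_sq
  · intro w hw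
    obtain ⟨h₁, h₂⟩ := reinhardt_ne_zero (shadow_pos hm) hw
    have : monomial a b w ≠ 0 := mul_ne_zero (pow_ne_zero _ h₁) (pow_ne_zero _ h₂)
    positivity

/-! ### The Toeplitz operator with symbol `φ` -/

lemma conj_unit (s : ℝ) : (starRingEnd ℂ) (unit s) = (unit s)⁻¹ := by
  rw [Complex.inv_eq_conj (norm_unit s)]

lemma unit_pi_div_zpow {n : ℤ} (hn : n ≠ 0) : unit (Real.pi / n) ^ n = -1 := by
  have : (n : ℂ) ≠ 0 := by exact_mod_cast hn
  rw [unit, ← Complex.exp_int_mul, ← Complex.exp_pi_mul_I]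
  congr 1
  push_cast
  field_simp

/-- The integral of a function that transforms under rotations by a nontrivial character is zero. -/
lemma integral_eq_zero_of_character {S : Set (ℝ × ℝ)} (hS : MeasurableSet S) {k : ℂ × ℂ → ℂ}
    (hk : Measurable k) {p q : ℤ} (hpq : p ≠ 0 ∨ q ≠ 0)
    (h : ∀ τ z, k (rot τ z) = unit τ.1 ^ p * unit τ.2 ^ q * k z) :
    ∫ z in reinhardt S, k z = 0 := by
  have hinv : ∀ τ : ℝ × ℝ, ∫ z in reinhardt S, k z =
      unit τ.1 ^ p * unit τ.2 ^ q * ∫ z in reinhardt S, k z := by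
    intro τ
    have hmp := measurePreserving_rot hS τ
    rw [← integral_const_mul]
    simp only [← h]
    rw [← integral_map (f := k) hmp.measurable.aemeasurable hk.aestronglyMeasurable, hmp.map_eq]
  have h0 : unit 0 = 1 := by simp [unit]
  -- At the angle `π / p` (or `π / q`) the character equals `-1`, so the integral is its own
  -- negative.
  rcases hpq with hp | hq
  · have := hinv (Real.pi / p, 0)
    simp only [unit_pi_div_zpow hp, h0, one_zpow, mul_one, neg_one_mul] at this
    exact self_eq_neg.1 this
  · have := hinv (0, Real.pi / q)
    simp only [unit_pi_div_zpow hq, h0, one_zpow, one_mul, neg_one_mul] at this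
    exact self_eq_neg.1 this

lemma ae_Omega_iff {m : ℕ} {p : ℂ × ℂ → Prop} :
    (∀ᵐ z ∂volume.restrict (Omega m : Set (ℂ × ℂ)), p z) ↔
      ∀ᵐ z ∂volume.restrict (reinhardt (shadow m)), p z := by
  rw [restrict_Omega]

lemma setIntegral_Omega (m : ℕ) (F : ℂ × ℂ → ℂ) :
    ∫ z in (Omega m : Set (ℂ × ℂ)), F z = ∫ z in reinhardt (shadow m), F z := by
  rw [restrict_Omega]

open Classical in
/-- The monomial `z₁ ^ a * z₂ ^ b` as an element of the Bergman space of `Ω_m`, or `0` if it is not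
square integrable. -/
def bergmanMonomial (m a b : ℕ) : bergmanSpace (Omega m) :=
  if h : MemLp (monomial a b) 2 (volume.restrict (Omega m : Set (ℂ × ℂ))) then
    ⟨h.toLp, monomial a b, by unfold monomial; fun_prop, h.coeFn_toLp⟩
  else 0

lemma coeFn_bergmanMonomial {m a b : ℕ} (hm : 1 ≤ m) (h : a ≤ b ∧ 2 * b + 2 ≤ 2 * a + m) :
    ((bergmanMonomial m a b : L2 (Omega m)) : ℂ × ℂ → ℂ)
      =ᵐ[volume.restrict (reinhardt (shadow m))] monomial a b := by
  have h' : MemLp (monomial a b) 2 (volume.restrict (Omega m : Set (ℂ × ℂ))) := by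
    rw [restrict_Omega]; exact (memLp_monomial_iff hm a b).2 h
  rw [← restrict_Omega, bergmanMonomial, dif_pos h']
  exact h'.coeFn_toLp

lemma bergmanMonomial_eq_zero {m a b : ℕ} (hm : 1 ≤ m) (h : ¬ (a ≤ b ∧ 2 * b + 2 ≤ 2 * a + m)) :
    bergmanMonomial m a b = 0 := by
  rw [bergmanMonomial, dif_neg]
  rwa [restrict_Omega, memLp_monomial_iff hm]

lemma inner_bergmanMonomial {m a b : ℕ} (hm : 1 ≤ m) (h : a ≤ b ∧ 2 * b + 2 ≤ 2 * a + m)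
    {f : L2 (Omega m)} {g : ℂ × ℂ → ℂ}
    (hfg : f =ᵐ[volume.restrict (reinhardt (shadow m))] g) :
    inner ℂ (bergmanMonomial m a b : L2 (Omega m)) f =
      ∫ z in reinhardt (shadow m), g z * (starRingEnd ℂ) (monomial a b z) := by
  rw [L2.inner_def, setIntegral_Omega]
  refine integral_congr_ae ?_
  filter_upwards [coeFn_bergmanMonomial hm h, hfg] with z h1 h2
  rw [h1, h2, RCLike.inner_apply]

/-- The square integrable monomials are total in the Bergman space. -/
lemma eq_zero_of_inner_bergmanMonomial {m : ℕ} (hm : 1 ≤ m) (f : bergmanSpace (Omega m))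
    (h : ∀ a b, a ≤ b ∧ 2 * b + 2 ≤ 2 * a + m → inner ℂ (bergmanMonomial m a b) f = 0) :
    f = 0 := by
  obtain ⟨f, g, hg, hfg⟩ := f
  have hfg' : f =ᵐ[volume.restrict (reinhardt (shadow m))] g := ae_Omega_iff.1 hfg
  have hg2 : MemLp g 2 (volume.restrict (reinhardt (shadow m))) := by
    rw [← restrict_Omega]
    exact (memLp_congr_ae hfg).1 (Lp.memLp f)
  have hz : ∀ z ∈ reinhardt (shadow m), g z = 0 := fun z hz =>
    eq_zero_of_orthogonal hm hg hg2 (fun a b h1 h2 => by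
      rw [← inner_bergmanMonomial hm ⟨h1, h2⟩ hfg']; exact h a b ⟨h1, h2⟩) hz
  ext1
  refine Lp.eq_zero_iff_ae_eq_zero.2 (ae_Omega_iff.2 ?_)
  filter_upwards [hfg', ae_restrict_mem (isOpen_reinhardt (isOpen_shadow m)).measurableSet]
    with z h1 h2
  rw [h1, hz z h2, Pi.zero_apply]

/-- The span of the monomials is dense, its orthogonal complement being trivial. -/
lemma ext_bergmanMonomial {m : ℕ} (hm : 1 ≤ m)
    {A B : bergmanSpace (Omega m) →L[ℂ] bergmanSpace (Omega m)}
    (h : ∀ a b, a ≤ b ∧ 2 * b + 2 ≤ 2 * a + m →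
      A (bergmanMonomial m a b) = B (bergmanMonomial m a b)) : A = B := by
  let s : Set (bergmanSpace (Omega m)) :=
    {f | ∃ a b, (a ≤ b ∧ 2 * b + 2 ≤ 2 * a + m) ∧ bergmanMonomial m a b = f}
  refine ContinuousLinearMap.ext_on (s := s) ?_ ?_
  · rw [Submodule.dense_iff_topologicalClosure_eq_top, Submodule.topologicalClosure_eq_top_iff,
      eq_bot_iff]
    intro f hf
    exact eq_zero_of_inner_bergmanMonomial hm f fun a b hab =>
      hf _ (Submodule.subset_span ⟨a, b, hab, rfl⟩)
  · rintro _ ⟨a, b, hab, rfl⟩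
    exact h a b hab

lemma measurable_phi : Measurable phi :=
  measurable_fst.div (Complex.continuous_conj.measurable.comp measurable_fst)

lemma phi_rot (τ : ℝ × ℝ) (z : ℂ × ℂ) : phi (rot τ z) = unit τ.1 ^ (2 : ℤ) * phi z := by
  have := unit_ne_zero τ.1
  simp only [phi, rot, map_mul, conj_unit]
  rw [mul_div_mul_comm, div_inv_eq_mul, zpow_ofNat, sq]

lemma monomial_rot (a b : ℕ) (τ : ℝ × ℝ) (z : ℂ × ℂ) :
    monomial a b (rot τ z) = unit τ.1 ^ (a : ℤ) * unit τ.2 ^ (b : ℤ) * monomial a b z := by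
  simp only [monomial, rot, mul_pow, zpow_natCast]
  ring

lemma conj_monomial_rot (a b : ℕ) (τ : ℝ × ℝ) (z : ℂ × ℂ) :
    (starRingEnd ℂ) (monomial a b (rot τ z)) = unit τ.1 ^ (-(a : ℤ)) * unit τ.2 ^ (-(b : ℤ)) *
      (starRingEnd ℂ) (monomial a b z) := by
  simp only [monomial_rot, map_mul, map_zpow₀, conj_unit, inv_zpow, zpow_neg]

lemma measurable_conj_monomial (a b : ℕ) :
    Measurable fun z => (starRingEnd ℂ) (monomial a b z) :=
  (Complex.continuous_conj.comp (continuous_monomial a b)).measurable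

lemma inner_bergmanMonomial_of_ne {m a b a' b' : ℕ} (hm : 1 ≤ m)
    (h : a ≤ b ∧ 2 * b + 2 ≤ 2 * a + m) (h' : a' ≤ b' ∧ 2 * b' + 2 ≤ 2 * a' + m)
    (hne : a ≠ a' ∨ b ≠ b') :
    inner ℂ (bergmanMonomial m a' b') (bergmanMonomial m a b) = 0 := by
  rw [Submodule.coe_inner, inner_bergmanMonomial hm h' (coeFn_bergmanMonomial hm h)]
  refine integral_eq_zero_of_character (isOpen_shadow m).measurableSet
    ((continuous_monomial a b).measurable.mul (measurable_conj_monomial a' b'))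
    (p := a - a') (q := b - b') (by omega) fun τ z => ?_
  rw [monomial_rot, conj_monomial_rot, sub_eq_add_neg, sub_eq_add_neg,
    zpow_add₀ (unit_ne_zero _), zpow_add₀ (unit_ne_zero _)]
  ring

lemma bergmanMonomial_ne_zero {m a b : ℕ} (hm : 1 ≤ m) (h : a ≤ b ∧ 2 * b + 2 ≤ 2 * a + m) :
    bergmanMonomial m a b ≠ 0 := by
  intro h0
  have h1 := coeFn_bergmanMonomial hm h
  rw [h0] at h1
  have h2 := ae_Omega_iff.1
    (Lp.coeFn_zero ℂ 2 ((volume : Measure (ℂ × ℂ)).restrict (Omega m : Set (ℂ × ℂ))))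
  have h3 : ∀ᵐ z ∂(volume.restrict (reinhardt (shadow m))), False := by
    filter_upwards [h1, h2, ae_restrict_mem (isOpen_reinhardt (isOpen_shadow m)).measurableSet]
      with z h1 h2 h3
    obtain ⟨h₁, h₂⟩ := reinhardt_ne_zero (shadow_pos hm) h3
    rw [ZeroMemClass.coe_zero, h2] at h1
    exact mul_ne_zero (pow_ne_zero a h₁) (pow_ne_zero b h₂) h1.symm
  rw [eventually_false_iff_eq_bot, ae_eq_bot, Measure.restrict_eq_zero] at h3
  exact absurd h3 (ne_of_gt ((isOpen_reinhardt (isOpen_shadow m)).measure_pos volume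
    ⟨_, one_mem_reinhardt_shadow m⟩))

/-- The Toeplitz operator on `A²(Ω_m)` with symbol `φ`. -/
abbrev T (m : ℕ) : bergmanSpace (Omega m) →L[ℂ] bergmanSpace (Omega m) :=
  toeplitz (Omega m) phi (memLp_phi _)

lemma coeFn_mulOperator (Ω : TopologicalSpace.Opens (ℂ × ℂ)) (u : ℂ × ℂ → ℂ)
    (hu : MemLp u ∞ (volume.restrict (Ω : Set (ℂ × ℂ)))) (f : L2 Ω) :
    mulOperator Ω u hu f =ᵐ[volume.restrict (Ω : Set (ℂ × ℂ))] fun z => u z * f z := by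
  have h := ContinuousLinearMap.coeFn_holder (r := 2) (ContinuousLinearMap.mul ℂ ℂ) (hu.toLp u) f
  refine (show _ =ᵐ[_] _ from h).trans ?_
  filter_upwards [hu.coeFn_toLp] with z hz
  rw [hz]; rfl

/-- The Bergman projection disappears when paired with an element of the Bergman space. -/
lemma inner_T {m a b a' b' : ℕ} (hm : 1 ≤ m) (h : a ≤ b ∧ 2 * b + 2 ≤ 2 * a + m)
    (h' : a' ≤ b' ∧ 2 * b' + 2 ≤ 2 * a' + m) :
    inner ℂ (bergmanMonomial m a' b') (T m (bergmanMonomial m a b)) =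
      ∫ z in reinhardt (shadow m), phi z * monomial a b z *
        (starRingEnd ℂ) (monomial a' b' z) := by
  have h1 : inner ℂ (bergmanMonomial m a' b') (T m (bergmanMonomial m a b)) =
      inner ℂ (bergmanMonomial m a' b' : L2 (Omega m))
        (mulOperator (Omega m) phi (memLp_phi _) (bergmanMonomial m a b)) := by
    rw [Submodule.coe_inner]
    exact Submodule.inner_orthogonalProjectionOnto_eq_of_mem_left (K := bergmanSpace (Omega m)) _ _
  rw [h1, inner_bergmanMonomial hm h' (g := fun z => phi z * monomial a b z)]
  have h2 := ae_Omega_iff.1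
    (coeFn_mulOperator (Omega m) phi (memLp_phi _) (bergmanMonomial m a b))
  filter_upwards [h2, coeFn_bergmanMonomial hm h] with z h3 h4
  rw [h3, h4]

/-- `T_φ` maps the monomial `z₁ ^ a * z₂ ^ b` to a nonzero multiple of `z₁ ^ (a + 2) * z₂ ^ b`, or
to `0` if the latter is not square integrable. -/
lemma exists_T_bergmanMonomial {m a b : ℕ} (hm : 1 ≤ m) (h : a ≤ b ∧ 2 * b + 2 ≤ 2 * a + m) :
    ∃ c : ℂ, c ≠ 0 ∧ T m (bergmanMonomial m a b) = c • bergmanMonomial m (a + 2) b := by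
  -- `φ` has weight `(2, 0)`, so the integrand has the nonzero weight `(a + 2 - a', b - b')`.
  have hoff : ∀ a' b', a' ≤ b' ∧ 2 * b' + 2 ≤ 2 * a' + m → (a + 2 ≠ a' ∨ b ≠ b') →
      inner ℂ (bergmanMonomial m a' b') (T m (bergmanMonomial m a b)) = 0 := by
    intro a' b' h' hne
    rw [inner_T hm h h']
    refine integral_eq_zero_of_character (isOpen_shadow m).measurableSet
      ((measurable_phi.mul (continuous_monomial a b).measurable).mul
        (measurable_conj_monomial a' b')) (p := 2 + a - a') (q := b - b') (by omega) fun τ z => ?_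
    rw [phi_rot, monomial_rot, conj_monomial_rot, sub_eq_add_neg, sub_eq_add_neg,
      zpow_add₀ (unit_ne_zero _), zpow_add₀ (unit_ne_zero _), zpow_add₀ (unit_ne_zero _)]
    ring
  by_cases h2 : a + 2 ≤ b ∧ 2 * b + 2 ≤ 2 * (a + 2) + m
  swap
  · refine ⟨1, one_ne_zero, ?_⟩
    rw [bergmanMonomial_eq_zero hm h2, smul_zero]
    refine eq_zero_of_inner_bergmanMonomial hm _ fun a' b' h' => hoff a' b' h' ?_
    by_contra hc
    push Not at hc
    obtain ⟨rfl, rfl⟩ := hc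
    exact h2 h'
  set e := bergmanMonomial m (a + 2) b
  have he : inner ℂ e e ≠ 0 := inner_self_ne_zero.2 (bergmanMonomial_ne_zero hm h2)
  have hpos : inner ℂ e (T m (bergmanMonomial m a b)) ≠ 0 := by
    rw [inner_T hm h h2]
    have hV := (isOpen_reinhardt (isOpen_shadow m)).measurableSet
    set k := fun z => phi z * monomial a b z * (starRingEnd ℂ) (monomial (a + 2) b z) with hk
    -- Dividing by `conj z₁` removes one of its `a + 2` factors, leaving `a + 1` of each kind. The
    -- exponent `(a + 1, b)` is in the band because both neighbours are, so the integral is finite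
    -- and positive.
    have hnorm : ∀ z ∈ reinhardt (shadow m), k z = ((‖monomial (a + 1) b z‖ ^ 2 : ℝ) : ℂ) := by
      intro z hz
      obtain ⟨h₁, h₂⟩ := reinhardt_ne_zero (shadow_pos hm) hz
      have h₁' : (starRingEnd ℂ) z.1 ≠ 0 := by simpa using h₁
      push_cast
      rw [← Complex.mul_conj']
      simp only [hk, phi, monomial, map_mul, map_pow]
      field_simp
      ring
    have hmon : MemLp (monomial (a + 1) b) 2 (volume.restrict (reinhardt (shadow m))) :=
      (memLp_monomial_iff hm _ _).2 (by omega)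
    rw [setIntegral_congr_fun hV hnorm, integral_complex_ofReal, Complex.ofReal_ne_zero]
    refine ne_of_gt (setIntegral_pos hV ?_ hmon.norm.integrable_sq fun z hz => ?_)
    · exact ((isOpen_reinhardt (isOpen_shadow m)).measure_pos volume
        ⟨_, one_mem_reinhardt_shadow m⟩).ne'
    · obtain ⟨h₁, h₂⟩ := reinhardt_ne_zero (shadow_pos hm) hz
      have : monomial (a + 1) b z ≠ 0 := mul_ne_zero (pow_ne_zero _ h₁) (pow_ne_zero _ h₂)
      positivity
  refine ⟨inner ℂ e (T m (bergmanMonomial m a b)) / inner ℂ e e, div_ne_zero hpos he, ?_⟩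
  refine sub_eq_zero.1 (eq_zero_of_inner_bergmanMonomial hm _ fun a' b' h' => ?_)
  rw [inner_sub_right, inner_smul_right (bergmanMonomial m a' b') e]
  by_cases hne : a + 2 ≠ a' ∨ b ≠ b'
  · rw [hoff a' b' h' hne, inner_bergmanMonomial_of_ne hm h2 h' hne, mul_zero, sub_zero]
  · push Not at hne
    obtain ⟨rfl, rfl⟩ := hne
    rw [div_mul_cancel₀ _ he, sub_self]

/-! ### Powers of `T_φ`: nilpotency index and rank -/

lemma exists_T_pow_bergmanMonomial {m a b : ℕ} (hm : 1 ≤ m) (h : a ≤ b ∧ 2 * b + 2 ≤ 2 * a + m)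
    (k : ℕ) : ∃ c : ℂ, c ≠ 0 ∧
      (T m ^ k) (bergmanMonomial m a b) = c • bergmanMonomial m (a + 2 * k) b := by
  induction k with
  | zero => exact ⟨1, one_ne_zero, by simp⟩
  | succ k ih =>
    obtain ⟨c, hc, ih⟩ := ih
    rw [pow_succ', mul_apply_eq_comp, ih, map_smul]
    by_cases h2 : a + 2 * k ≤ b ∧ 2 * b + 2 ≤ 2 * (a + 2 * k) + m
    · obtain ⟨c', hc', h3⟩ := exists_T_bergmanMonomial hm h2
      exact ⟨c * c', mul_ne_zero hc hc', by rw [h3, smul_smul]; rfl⟩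
    -- Raising `a` preserves the second inequality, so the band is left only through `a ≤ b` and
    -- never re-entered; the default value `0` of `bergmanMonomial` keeps the formula valid.
    · refine ⟨1, one_ne_zero, ?_⟩
      rw [bergmanMonomial_eq_zero hm h2, bergmanMonomial_eq_zero hm (by omega), map_zero, smul_zero,
        smul_zero]

lemma nilpotencyClass_T {m : ℕ} (hm : 2 ≤ m) : nilpotencyClass (T m) = (m + 2) / 4 := by
  have hm1 : 1 ≤ m := by omega
  rw [show (m + 2) / 4 = (m - 2) / 4 + 1 by omega, nilpotencyClass_eq_succ_iff]
  constructor
  · refine ext_bergmanMonomial hm1 fun a b hab => ?_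
    obtain ⟨c, -, hT⟩ := exists_T_pow_bergmanMonomial hm1 hab ((m - 2) / 4 + 1)
    rw [hT, bergmanMonomial_eq_zero hm1 (by omega), smul_zero, _root_.zero_apply]
  · intro h0
    -- The start with `b - a` the largest even number in the band: `(m - 2) / 4` steps end exactly
    -- on the diagonal `a = b`, still nonzero.
    obtain ⟨c, hc, hT⟩ := exists_T_pow_bergmanMonomial (m := m) (a := 0) (b := 2 * ((m - 2) / 4))
      hm1 (by omega) ((m - 2) / 4)
    rw [h0, _root_.zero_apply] at hT
    exact smul_ne_zero hc (bergmanMonomial_ne_zero hm1 (by omega)) hT.symm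

lemma not_finiteDimensional_range_T {m : ℕ} (hm : 6 ≤ m) :
    ¬ FiniteDimensional ℂ (LinearMap.range (T m).toLinearMap) := by
  intro hfin
  have hm1 : 1 ≤ m := by omega
  have hmem : ∀ n, bergmanMonomial m (n + 2) (n + 2) ∈ LinearMap.range (T m).toLinearMap := by
    intro n
    -- The offset `b - a = 2` is allowed precisely when `6 ≤ m`; every diagonal monomial from
    -- exponent 2 on is then in the range.
    obtain ⟨c, hc, hT⟩ := exists_T_bergmanMonomial (m := m) (a := n) (b := n + 2) hm1 (by omega)
    refine ⟨c⁻¹ • bergmanMonomial m n (n + 2), ?_⟩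
    rw [map_smul]
    change c⁻¹ • T m _ = _
    rw [hT, smul_smul, inv_mul_cancel₀ hc, one_smul]
  have hli : LinearIndependent ℂ fun n => bergmanMonomial m (n + 2) (n + 2) := by
    refine linearIndependent_of_ne_zero_of_inner_eq_zero
      (fun n => bergmanMonomial_ne_zero hm1 (by omega)) fun i j hij => ?_
    exact inner_bergmanMonomial_of_ne hm1 (by omega) (by omega) (by omega)
  have hli' : LinearIndependent ℂ
      fun n => (⟨_, hmem n⟩ : LinearMap.range (T m).toLinearMap) :=
    LinearIndependent.of_comp (LinearMap.range (T m).toLinearMap).subtype hli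
  exact not_finite_iff_infinite.2 inferInstance hli'.finite

end Bergman

end

theorem theorem1 (m : ℕ) (hm : 6 ≤ m) :
    Bergman.IsReinhardtDomain (Bergman.Omega m : Set (ℂ × ℂ)) ∧
    ¬ Bornology.IsBounded (Bergman.Omega m : Set (ℂ × ℂ)) ∧
    volume (Bergman.Omega m : Set (ℂ × ℂ)) < ∞ ∧
    Bergman.toeplitz (Bergman.Omega m) Bergman.phi (Bergman.memLp_phi _) ≠ 0 ∧
    ¬ FiniteDimensional ℂ (LinearMap.range
      (Bergman.toeplitz (Bergman.Omega m) Bergman.phi (Bergman.memLp_phi _)).toLinearMap) ∧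
    IsNilpotent (Bergman.toeplitz (Bergman.Omega m) Bergman.phi (Bergman.memLp_phi _)) ∧
    nilpotencyClass (Bergman.toeplitz (Bergman.Omega m) Bergman.phi (Bergman.memLp_phi _)) =
      (m + 2) / 4 := by
  have hclass := Bergman.nilpotencyClass_T (m := m) (by omega)
  have hrank := Bergman.not_finiteDimensional_range_T hm
  refine ⟨Bergman.isReinhardtDomain_Omega (by omega), Bergman.not_isBounded_Omega m,
    Bergman.volume_Omega_lt_top (by omega), fun h0 => hrank ?_, hrank, ?_, hclass⟩
  · rw [Bergman.T, h0, ContinuousLinearMap.toLinearMap_zero, LinearMap.range_zero]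
    infer_instance
  -- `nilpotencyClass` defaults to 0 for operators that are not nilpotent, so nilpotency is read off
  -- from its value being a successor.
  · rw [show (m + 2) / 4 = (m - 2) / 4 + 1 by omega, nilpotencyClass_eq_succ_iff] at hclass
    exact ⟨_, hclass.1⟩
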